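/- Strings are elements of $2^{<\omega}$, and $X\upharpoonright n$ is the length-$n$ initial segment of $X\in2^\omega$. Let $U$ be a universal prefix-free machine: a Turing machine computing a partial function on strings with prefix-free domain, such that for every partial computable $V:\subseteq 2^{<\omega}\to2^{<\omega}$ with prefix-free domain there is a constant $c$ such that whenever $V(\sigma)=\tau$ there is $\rho$ with $|\rho|\le|\sigma|+c$ and $U(\rho)=\tau$. Put $K(\tau)=\min\{|\sigma| : U(\sigma)=\tau\}$ and, for a function $t:\omega\to\omega$, $K^t(\tau)=\min\{|\sigma| : U(\sigma)=\tau \text{ in at most } t(|\tau|) \text{ steps}\}$ (with $\min\emptyset=\infty$). A computable time bound is a computable nondecreasing function $t:\omega\to\omega$; an order is a nondecreasing unbounded function $g:\omega\to\omega$. A continuous semimeasure is a function $P:2^{<\omega}\to[0,1]$ with $P(\sigma)\ge P(\sigma0)+P(\sigma1)$ for all $\sigma$. Let $\mathbf M$ be a universal lower semicomputable continuous semimeasure, i.e. one such that for every lower semicomputable continuous semimeasure $P$ there is a constant $c$ with $P\le c\cdot\mathbf M$. For a $\Pi^0_1$ class $\mathcal P\subseteq2^\omega$ let $T_n=\{X\upharpoonright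 n : X\in\mathcal P\}$. The class $\mathcal P$ is deep if there is a computable order $h$ such that $\sum_{\sigma\in T_n}\mathbf M(\sigma)\le2^{-h(n)}$ for all $n$. Theorem. Every member $X$ of a deep $\Pi^0_1$ class is order-deep: there is a computable order $g$ such that, for every computable time bound $t$, $$K^t(X\upharpoonright n)-K(X\upharpoonright n)\ge g(n)\quad\text{for almost all } n.$$ In particular every such $X$ is strongly deep: for every computable time bound $t$, $K^t(X\upharpoonright n)-K(X\upharpoonright n)\to\infty$ as $n\to\infty$. -/

import Mathlib

open Filter Topology

namespace DeepClasses

/-! ### Strings and sequences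

Strings are `List Bool`, sequences are `ℕ → Bool`. -/

/-- The initial segment of length `n` of the sequence `X`. -/
def initSeg (X : ℕ → Bool) (n : ℕ) : List Bool :=
  List.ofFn fun i : Fin n => X i

/-- A set of strings that contains no proper extension of any of its members. -/
def PrefixFree (D : Set (List Bool)) : Prop :=
  ∀ σ ∈ D, ∀ ρ ∈ D, σ <+: ρ → σ = ρ

/-- An order: a nondecreasing and unbounded function. -/
def IsOrder (g : ℕ → ℕ) : Prop :=
  Monotone g ∧ ∀ k, ∃ n, k ≤ g n

/-- A computable time bound: a computable, total, nondecreasing function. -/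
def IsComputableTimeBound (t : ℕ → ℕ) : Prop :=
  Computable t ∧ Monotone t

/-! ### Turing machines and prefix-free complexity

A machine is a multi-stack Turing machine with finite control that reads a binary string from its
input stack and writes a binary string on its output stack. -/

/-- A (multi-stack) Turing machine with binary input and binary output. -/
abbrev Machine := Turing.TM2ComputableAux Bool Bool

/-- The machine `U` halts on input `σ` with output `τ`. -/
def Outputs (U : Machine) (σ τ : List Bool) : Prop :=
  Nonempty (Turing.TM2Outputs U.tm (σ.map U.inputAlphabet.symm)
    (some (τ.map U.outputAlphabet.symm)))

/-- The machine `U` halts on input `σ` with output `τ` after at most `s` steps. -/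
def OutputsInTime (U : Machine) (σ τ : List Bool) (s : ℕ) : Prop :=
  Nonempty (Turing.TM2OutputsInTime U.tm (σ.map U.inputAlphabet.symm)
    (some (τ.map U.outputAlphabet.symm)) s)

/-- `U` is a universal prefix-free machine: a Turing machine (with finite stack alphabets) whose
domain is prefix-free and which simulates every prefix-free machine, that is, every partial
computable function `V` on strings with prefix-free domain, with programs that are longer by at most
a constant depending only on `V`. In particular this covers the machines `U` such that for every
such `V` there is a string `π` with `U (π ++ σ) = V σ` for all `σ`. -/
structure IsUniversalPrefixFree (U : Machine) : Prop where
  finite_alphabet : ∀ k, Finite (U.tm.Γ k)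
  prefixFree : PrefixFree {σ | ∃ τ, Outputs U σ τ}
  universal : ∀ V : List Bool →. List Bool, Partrec V → PrefixFree {σ | (V σ).Dom} →
    ∃ c : ℕ, ∀ σ τ, τ ∈ V σ → ∃ ρ : List Bool, ρ.length ≤ σ.length + c ∧ Outputs U ρ τ

/-- The prefix-free complexity of `τ`: the least length of a program for `τ` (`⊤` if there is no
program). -/
noncomputable def K (U : Machine) (τ : List Bool) : ℕ∞ :=
  ⨅ (σ : List Bool) (_ : Outputs U σ τ), (σ.length : ℕ∞)

/-- The time-bounded complexity `K^t` of `τ`: the least length of a program that outputs `τ` in at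
most `t |τ|` steps (`⊤` if there is no such program). -/
noncomputable def timeK (U : Machine) (t : ℕ → ℕ) (τ : List Bool) : ℕ∞ :=
  ⨅ (σ : List Bool) (_ : OutputsInTime U σ τ (t τ.length)), (σ.length : ℕ∞)

/-- `X` is strongly deep: for every computable time bound `t`, the difference
`K^t (X ↾ n) - K (X ↾ n)` tends to infinity. The inequality `c ≤ K^t - K` is written
`K + c ≤ K^t`. -/
def IsStronglyDeep (U : Machine) (X : ℕ → Bool) : Prop :=
  ∀ t : ℕ → ℕ, IsComputableTimeBound t → ∀ c : ℕ,
    ∀ᶠ n in atTop, K U (initSeg X n) + c ≤ timeK U t (initSeg X n)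

/-- `X` is order-deep: there is a computable order `g` such that, for every computable time bound
`t`, `K^t (X ↾ n) - K (X ↾ n) ≥ g n` for almost all `n`. -/
def IsOrderDeep (U : Machine) (X : ℕ → Bool) : Prop :=
  ∃ g : ℕ → ℕ, Computable g ∧ IsOrder g ∧
    ∀ t : ℕ → ℕ, IsComputableTimeBound t →
      ∀ᶠ n in atTop, K U (initSeg X n) + g n ≤ timeK U t (initSeg X n)

/-! ### Continuous semimeasures -/

/-- A continuous semimeasure. -/
structure IsContinuousSemimeasure (P : List Bool → ℝ) : Prop where
  nonneg : ∀ σ, 0 ≤ P σ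
  root_le_one : P [] ≤ 1
  superadditive : ∀ σ, P (σ ++ [false]) + P (σ ++ [true]) ≤ P σ

/-- A nonnegative function on strings is lower semicomputable if each of its values is the limit of
a computable nondecreasing sequence of nonnegative rationals `a σ s / (b σ s + 1)`, uniformly in
the string. -/
def LowerSemicomputable (f : List Bool → ℝ) : Prop :=
  ∃ a b : List Bool → ℕ → ℕ, Computable₂ a ∧ Computable₂ b ∧
    ∀ σ, Monotone (fun s => (a σ s : ℝ) / ((b σ s : ℝ) + 1)) ∧
      Tendsto (fun s => (a σ s : ℝ) / ((b σ s : ℝ) + 1)) atTop (𝓝 (f σ))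

/-- `M` is a universal (lower semicomputable) continuous semimeasure: it dominates every lower
semicomputable continuous semimeasure up to a multiplicative constant. -/
structure IsUniversalSemimeasure (M : List Bool → ℝ) : Prop where
  semimeasure : IsContinuousSemimeasure M
  lowerSemicomputable : LowerSemicomputable M
  dominates : ∀ P : List Bool → ℝ, IsContinuousSemimeasure P → LowerSemicomputable P →
    ∃ c : ℝ, ∀ σ, P σ ≤ c * M σ

/-! ### Deep `Π⁰₁` classes -/

/-- A `Π⁰₁` class: the set of all sequences none of whose initial segments lies in a given
computably enumerable set of strings. -/
def IsPi01Class (P : Set (ℕ → Bool)) : Prop :=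
  ∃ W : List Bool → Prop, REPred W ∧ P = {X | ∀ n, ¬ W (initSeg X n)}

/-- The `n`-th level of the canonical tree of `P`, which consists of all initial segments of members
of `P`. This is a finite set of strings. -/
def treeLevel (P : Set (ℕ → Bool)) (n : ℕ) : Set (List Bool) :=
  {σ | ∃ X ∈ P, σ = initSeg X n}

/-- `P` is a deep `Π⁰₁` class: for some computable order `g`, the total `M`-weight of the `n`-th
level of the canonical tree of `P` is at most `2 ^ (-g n)` for all `n`. -/
def IsDeepClass (M : List Bool → ℝ) (P : Set (ℕ → Bool)) : Prop :=
  IsPi01Class P ∧ ∃ g : ℕ → ℕ, Computable g ∧ IsOrder g ∧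
    ∀ n, ∑' σ : treeLevel P n, M σ ≤ (2 : ℝ)⁻¹ ^ g n

end DeepClasses

/-! Let `h` be the order witnessing depth, and let block `k` consist of the lengths `n` with `h n /
2 = k`. All these lengths are at least `m = blockStart hh k`, and the tree level at `m` has
`M`-measure at most `2 ^ (-2k)`. The probability that `U` outputs an extension of `τ` is a lower
semicomputable semimeasure of `τ`, so it is at most `2 ^ C * M τ`. Hence all programs whose outputs
extend strings of level `m` have total weight at most `2 ^ C * 2 ^ (-2k)`, whatever the lengths of
these outputs (`exists_sum_programWeight_le`).

The tree of a `Π⁰₁` class is not computable, but it is approximated from above. The time bound `t`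
leaves only finitely many, computably bounded, candidate pairs (program, output) in a block, so one
can search for a stage at which the pairs that still look admissible have weight at most `2 ^ C * 2
^ (-2k)`. By compactness the search ends (`exists_computable_stage`).

For each pair `(ρ, τ)` surviving at that stage, request a program for `τ` of length `|ρ| + C + 1 -
k`. Block `k` then asks for weight at most `2 ^ (-k-1)`: half of the exponent `2k` pays for the gain
`k`, the other half makes the sum over all blocks converge. The machine existence theorem
(`exists_programs`) serves the requests. Initial segments of members of the class are never
discarded, so `K (X ↾ n) + h n / 2 ≤ K^t (X ↾ n) + c`. Only `c` depends on `t`, and the order `h n /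
4` absorbs it. -/

namespace DeepClasses

/-! ### Simulation of stack machines -/

section Simulation

open Turing Function

variable {K : Type} {Γ : K → Type} {Λ σ G : Type} {n : ℕ}

/-- Stacks over the alphabets `Γ k`, recoded as finitely many lists over one alphabet. -/
def encodeStacks (e : K ≃ Fin n) (ι : ∀ k, Γ k → G) (S : ∀ k, List (Γ k)) : Fin n → List G :=
  fun i => (S (e.symm i)).map (ι (e.symm i))

/-- Configurations of a stack machine, recoded without dependent types. -/
def encodeCfg (e : K ≃ Fin n) (ι : ∀ k, Γ k → G) (c : TM2.Cfg Γ Λ σ) :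
    Option Λ × σ × (Fin n → List G) :=
  (c.l, c.var, encodeStacks e ι c.stk)

theorem encodeStacks_apply (e : K ≃ Fin n) (ι : ∀ k, Γ k → G) (S : ∀ k, List (Γ k)) (k : K) :
    encodeStacks e ι S (e k) = (S k).map (ι k) := by
  have h : ∀ j, j = k → (S j).map (ι j) = (S k).map (ι k) := by rintro j rfl; rfl
  exact h _ (e.symm_apply_apply k)

theorem encodeCfg_injective (e : K ≃ Fin n) (ι : ∀ k, Γ k → G) (hι : ∀ k, Injective (ι k)) :
    Injective (encodeCfg (Λ := Λ) (σ := σ) e ι) := by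
  rintro ⟨l, v, S⟩ ⟨l', v', S'⟩ h
  simp only [encodeCfg, Prod.mk.injEq] at h
  obtain ⟨rfl, rfl, h⟩ := h
  congr 1
  funext k
  have := congrFun h (e k)
  rw [encodeStacks_apply, encodeStacks_apply] at this
  exact (hι k).list_map this

variable [DecidableEq K]

theorem encodeStacks_update (e : K ≃ Fin n) (ι : ∀ k, Γ k → G) (S : ∀ k, List (Γ k)) (k : K)
    (l : List (Γ k)) :
    encodeStacks e ι (update S k l) = update (encodeStacks e ι S) (e k) (l.map (ι k)) := by
  funext i
  obtain ⟨j, rfl⟩ := e.surjective i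
  rw [encodeStacks_apply]
  rcases eq_or_ne j k with rfl | h
  · simp
  · rw [update_of_ne h, update_of_ne (e.injective.ne h), encodeStacks_apply]

theorem primrec_update [Primcodable G] (j : Fin n) :
    Primrec fun p : (Fin n → G) × G => update p.1 j p.2 := by
  refine Primrec.fin_curry.2 ?_
  refine (Primrec.ite (Primrec.eq.comp Primrec.snd (Primrec.const j))
    (Primrec.snd.comp Primrec.fst)
    (Primrec.fin_app.comp (Primrec.fst.comp Primrec.fst) Primrec.snd)).of_eq ?_
  rintro ⟨⟨f, x⟩, i⟩
  simp [update_apply]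

theorem primrec₂_of_finite {α β : Type} [Primcodable Λ] [Finite Λ] [Primcodable α] [Primcodable β]
    {f : Λ → α → β} (hf : ∀ l, Primrec (f l)) : Primrec₂ f := by
  obtain ⟨m, ⟨e⟩⟩ := Finite.exists_equiv_fin Λ
  have h : Primrec₂ fun (i : Fin m) a => f (e.symm i) a := Primrec.fin_curry₁.2 fun i => hf _
  have he : Primrec e := Primrec.dom_finite _
  exact (h.comp (he.comp Primrec.fst) Primrec.snd).of_eq fun p => by simp

variable [Primcodable Λ] [Primcodable σ] [Primcodable G] [Finite σ] [Finite G]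

/-- Induction on the statement. The finitely many control data are handled by tables
(`Primrec.dom_finite`); only the list operations on the stacks are infinite. -/
theorem exists_primrec_stepAux (e : K ≃ Fin n) (ι : ∀ k, Γ k → G) (hι : ∀ k, Injective (ι k))
    (q : TM2.Stmt Γ Λ σ) :
    ∃ F : σ × (Fin n → List G) → Option Λ × σ × (Fin n → List G), Primrec F ∧
      ∀ v S, F (v, encodeStacks e ι S) = encodeCfg e ι (TM2.stepAux q v S) := by
  have hstack : ∀ k, Primrec fun p : σ × (Fin n → List G) => p.2 (e k) := fun k =>
    Primrec.fin_app.comp Primrec.snd (Primrec.const (e k))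
  -- The top symbol arrives as an element of `G`; the partial inverse of `ι k` recovers it, and its
  -- values off the range of `ι k` never matter.
  have hread : ∀ k (f : σ → Option (Γ k) → σ), ∃ φ : σ × (Fin n → List G) → σ, Primrec φ ∧
      ∀ v S, φ (v, encodeStacks e ι S) = f v (S k).head? := by
    intro k f
    have hφ : Primrec fun p : σ × Option G => f p.1 (p.2.bind (partialInv (ι k))) :=
      Primrec.dom_finite _
    refine ⟨_, hφ.comp (Primrec.fst.pair (Primrec.list_head?.comp (hstack k))), fun v S => ?_⟩
    dsimp only
    rw [encodeStacks_apply]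
    cases S k <;> simp [partialInv_left (hι k)]
  induction q with
  | push k f q ih =>
    obtain ⟨F, hF, h⟩ := ih
    have hf : Primrec fun v => ι k (f v) := Primrec.dom_finite _
    refine ⟨_, hF.comp (Primrec.fst.pair ((primrec_update (e k)).comp (Primrec.snd.pair
      (Primrec.list_cons.comp (hf.comp Primrec.fst) (hstack k))))), fun v S => ?_⟩
    simp only [TM2.stepAux, ← h, encodeStacks_update, encodeStacks_apply, List.map_cons]
  | peek k f q ih =>
    obtain ⟨F, hF, h⟩ := ih
    obtain ⟨φ, hφ, hφ'⟩ := hread k f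
    exact ⟨_, hF.comp (hφ.pair Primrec.snd), fun v S => by simp only [TM2.stepAux, ← h, hφ']⟩
  | pop k f q ih =>
    obtain ⟨F, hF, h⟩ := ih
    obtain ⟨φ, hφ, hφ'⟩ := hread k f
    refine ⟨_, hF.comp (hφ.pair ((primrec_update (e k)).comp (Primrec.snd.pair
      (Primrec.list_tail.comp (hstack k))))), fun v S => ?_⟩
    simp only [TM2.stepAux, ← h, hφ', encodeStacks_update, encodeStacks_apply, List.map_tail]
  | load f q ih =>
    obtain ⟨F, hF, h⟩ := ih
    have hf : Primrec f := Primrec.dom_finite _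
    exact ⟨_, hF.comp ((hf.comp Primrec.fst).pair Primrec.snd), fun v S => by
      simp only [TM2.stepAux, ← h]⟩
  | branch f q₁ q₂ ih₁ ih₂ =>
    obtain ⟨F₁, hF₁, h₁⟩ := ih₁
    obtain ⟨F₂, hF₂, h₂⟩ := ih₂
    have hf : Primrec f := Primrec.dom_finite _
    refine ⟨_, Primrec.cond (hf.comp Primrec.fst) hF₁ hF₂, fun v S => ?_⟩
    simp only [TM2.stepAux, h₁, h₂]
    cases f v <;> rfl
  | goto f =>
    have hf : Primrec fun v => some (f v) := Primrec.dom_finite _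
    exact ⟨_, (hf.comp Primrec.fst).pair Primrec.id, fun v S => rfl⟩
  | halt => exact ⟨_, (Primrec.const none).pair Primrec.id, fun v S => rfl⟩

theorem exists_primrec_step [Finite Λ] (e : K ≃ Fin n) (ι : ∀ k, Γ k → G) (hι : ∀ k, Injective (ι k))
    (m : Λ → TM2.Stmt Γ Λ σ) :
    ∃ F : Option Λ × σ × (Fin n → List G) → Option (Option Λ × σ × (Fin n → List G)), Primrec F ∧
      ∀ c, F (encodeCfg e ι c) = (TM2.step m c).map (encodeCfg e ι) := by
  choose F hF h using fun l => exists_primrec_stepAux e ι hι (m l)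
  have hF' : Primrec₂ fun (p : Option Λ × σ × (Fin n → List G)) l => some (F l p.2) :=
    Primrec.option_some.comp ((primrec₂_of_finite hF).comp Primrec.snd
      (Primrec.snd.comp Primrec.fst))
  refine ⟨_, Primrec.option_bind Primrec.fst hF', ?_⟩
  rintro ⟨_ | l, v, S⟩
  · rfl
  · simp [encodeCfg, TM2.step, h]

end Simulation

/-! ### Runs of a machine: uniqueness, decidability, length of programs. -/

open Turing

theorem initList_stk (tm : FinTM2) (s : List (tm.Γ tm.k₀)) :
    (initList tm s).stk = Function.update (fun _ => []) tm.k₀ s := by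
  funext k
  by_cases h : k = tm.k₀
  · subst h; simp [initList]
  · simp [initList, h]

theorem haltList_stk (tm : FinTM2) (s : List (tm.Γ tm.k₁)) :
    (haltList tm s).stk = Function.update (fun _ => []) tm.k₁ s := by
  funext k
  by_cases h : k = tm.k₁
  · subst h; simp [haltList]
  · simp [haltList, h]

theorem outputsInTime_iff {U : Machine} {ρ τ : List Bool} {s : ℕ} :
    OutputsInTime U ρ τ s ↔ ∃ i < s + 1,
      (fun o => Option.bind o U.tm.step)^[i] (some (initList U.tm (ρ.map U.inputAlphabet.symm))) =
        some (haltList U.tm (τ.map U.outputAlphabet.symm)) :=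
  ⟨fun ⟨h⟩ => ⟨h.steps, Nat.lt_succ_of_le h.steps_le_m, h.evals_in_steps⟩,
    fun ⟨i, hi, h⟩ => ⟨⟨⟨i, h⟩, Nat.le_of_lt_succ hi⟩⟩⟩

theorem outputs_iff {U : Machine} {ρ τ : List Bool} :
    Outputs U ρ τ ↔ ∃ s, OutputsInTime U ρ τ s :=
  ⟨fun ⟨h⟩ => ⟨h.steps, ⟨⟨h, le_rfl⟩⟩⟩, fun ⟨_, ⟨h⟩⟩ => ⟨h.toEvalsTo⟩⟩

theorem OutputsInTime.mono {U : Machine} {ρ τ : List Bool} {s s' : ℕ}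
    (h : OutputsInTime U ρ τ s) (hs : s ≤ s') : OutputsInTime U ρ τ s' :=
  let ⟨h⟩ := h
  ⟨⟨h.toEvalsTo, h.steps_le_m.trans hs⟩⟩

theorem haltList_injective (tm : FinTM2) : Function.Injective (haltList tm) := by
  intro s s' h
  have h := congrArg TM2.Cfg.stk h
  simp only [haltList_stk] at h
  simpa using congrFun h tm.k₁

/-- A halting configuration has no successor, so two runs from the same input that reach halting
configurations do so after the same number of steps. -/
theorem Outputs.unique {U : Machine} {ρ τ τ' : List Bool} (h : Outputs U ρ τ)
    (h' : Outputs U ρ τ') : τ = τ' := by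
  obtain ⟨s, h⟩ := outputs_iff.1 h
  obtain ⟨s', h'⟩ := outputs_iff.1 h'
  obtain ⟨i, -, h⟩ := outputsInTime_iff.1 h
  obtain ⟨j, -, h'⟩ := outputsInTime_iff.1 h'
  set f := fun o => Option.bind o U.tm.step
  have hnone : ∀ n, f^[n] none = none := fun n => Function.iterate_fixed rfl n
  have hstep : ∀ (s : List (U.tm.Γ U.tm.k₁)) n, f^[n] (some (haltList U.tm s)) ≠ none → n = 0 := by
    rintro s (_ | n) hn
    · rfl
    · exact absurd (hnone n) hn
  have key : haltList U.tm (τ.map U.outputAlphabet.symm) =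
      haltList U.tm (τ'.map U.outputAlphabet.symm) := by
    rcases le_total i j with hij | hij
    · obtain ⟨d, rfl⟩ := Nat.exists_eq_add_of_le' hij
      rw [Function.iterate_add_apply, h] at h'
      obtain rfl := hstep (τ.map U.outputAlphabet.symm) d (by simp [h'])
      exact Option.some.inj h'
    · obtain ⟨d, rfl⟩ := Nat.exists_eq_add_of_le' hij
      rw [Function.iterate_add_apply, h'] at h
      obtain rfl := hstep (τ'.map U.outputAlphabet.symm) d (by simp [h])
      exact (Option.some.inj h).symm
  exact U.outputAlphabet.symm.injective.list_map (haltList_injective _ key)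

/-- The recoding commutes with the step function and is injective, so the run can be simulated and
compared with the halting configuration on recoded data. -/
theorem primrecPred_outputsInTime (U : Machine) (hU : ∀ k, Finite (U.tm.Γ k)) :
    PrimrecPred fun p : (List Bool × List Bool) × ℕ => OutputsInTime U p.1.1 p.1.2 p.2 := by
  have := U.tm.kFin
  have := U.tm.ΛFin
  have := U.tm.σFin
  obtain ⟨n, ⟨e⟩⟩ := Finite.exists_equiv_fin U.tm.K
  let G := Σ k, U.tm.Γ k
  let _ : Primcodable U.tm.Λ := Primcodable.ofEquiv _ (Finite.equivFin _)
  let _ : Primcodable U.tm.σ := Primcodable.ofEquiv _ (Finite.equivFin _)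
  let _ : Primcodable G := Primcodable.ofEquiv _ (Finite.equivFin _)
  let ι : ∀ k, U.tm.Γ k → G := fun k x => ⟨k, x⟩
  have hι : ∀ k, Function.Injective (ι k) := fun k => sigma_mk_injective
  obtain ⟨F, hF, hstep⟩ := exists_primrec_step e ι hι U.tm.m
  have hsim : ∀ i (o : Option U.tm.Cfg), ((fun o => Option.bind o U.tm.step)^[i] o).map
      (encodeCfg e ι) = (fun o => Option.bind o F)^[i] (o.map (encodeCfg e ι)) := by
    intro i
    refine (Function.Semiconj.iterate_right (f := Option.map (encodeCfg e ι)) ?_ i)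
    rintro (_ | c)
    · rfl
    · simp only [Option.bind_some, Option.map_some]
      exact (hstep c).symm
  have hnil : encodeStacks e ι (fun _ => []) = fun _ => [] := rfl
  let inp (ρ : List Bool) : Option U.tm.Λ × U.tm.σ × (Fin n → List G) :=
    (some U.tm.main, U.tm.initialState, Function.update (fun _ => []) (e U.tm.k₀)
      (ρ.map fun b => ι _ (U.inputAlphabet.symm b)))
  let out (ρ : List Bool) : Option U.tm.Λ × U.tm.σ × (Fin n → List G) :=
    (none, U.tm.initialState, Function.update (fun _ => []) (e U.tm.k₁)
      (ρ.map fun b => ι _ (U.outputAlphabet.symm b)))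
  have hmap : ∀ f : Bool → G, Primrec fun ρ : List Bool => ρ.map f := fun f =>
    Primrec.list_map .id ((Primrec.dom_finite f).comp Primrec.snd)
  have hinp : Primrec inp := (Primrec.const _).pair ((Primrec.const _).pair
    ((primrec_update _).comp ((Primrec.const _).pair (hmap _))))
  have hout : Primrec out := (Primrec.const _).pair ((Primrec.const _).pair
    ((primrec_update _).comp ((Primrec.const _).pair (hmap _))))
  have hinp' : ∀ ρ, encodeCfg e ι (initList U.tm (ρ.map U.inputAlphabet.symm)) = inp ρ := by
    intro ρ
    simp only [encodeCfg, initList_stk, encodeStacks_update, hnil, List.map_map, inp]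
    rfl
  have hout' : ∀ ρ, encodeCfg e ι (haltList U.tm (ρ.map U.outputAlphabet.symm)) = out ρ := by
    intro ρ
    simp only [encodeCfg, haltList_stk, encodeStacks_update, hnil, List.map_map, out]
    rfl
  have hrun : PrimrecRel fun (i : ℕ) (p : List Bool × List Bool) =>
      (fun o => Option.bind o F)^[i] (some (inp p.1)) = some (out p.2) := by
    refine Primrec.eq.comp (Primrec.nat_iterate Primrec.fst (Primrec.option_some.comp
      (hinp.comp (Primrec.fst.comp Primrec.snd))) ?_)
      (Primrec.option_some.comp (hout.comp (Primrec.snd.comp Primrec.snd)))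
    exact Primrec.option_bind Primrec.snd (hF.comp Primrec.snd)
  refine (hrun.exists_mem_list.comp (Primrec.list_range.comp (Primrec.succ.comp Primrec.snd))
    Primrec.fst).of_eq ?_
  rintro ⟨⟨ρ, τ⟩, s⟩
  rw [outputsInTime_iff]
  simp only [List.mem_range]
  refine exists_congr fun i => and_congr_right fun _ => ?_
  refine Iff.trans ?_ (Option.map_injective (encodeCfg_injective e ι hι)).eq_iff
  rw [hsim]
  rw [← hinp', ← hout']
  exact Iff.rfl

/-- `B` bounds the number of `pop` instructions met while executing `q`. -/
theorem exists_stepAux_length_le {K : Type} [DecidableEq K] {Γ : K → Type} {Λ σ : Type}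
    (q : TM2.Stmt Γ Λ σ) :
    ∃ B : ℕ, ∀ v S k, (S k).length ≤ ((TM2.stepAux q v S).stk k).length + B := by
  induction q with
  | push k f q ih =>
    obtain ⟨B, h⟩ := ih
    refine ⟨B, fun v S j => le_trans ?_ (h _ _ j)⟩
    rcases eq_or_ne j k with rfl | hj
    · simp
    · simp [hj]
  | peek k f q ih =>
    obtain ⟨B, h⟩ := ih
    exact ⟨B, fun v S j => h _ _ j⟩
  | pop k f q ih =>
    obtain ⟨B, h⟩ := ih
    refine ⟨B + 1, fun v S j => ?_⟩
    have := h (f v (S k).head?) (Function.update S k (S k).tail) j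
    simp only [TM2.stepAux]
    rcases eq_or_ne j k with rfl | hj
    · simp only [Function.update_self, List.length_tail] at this
      omega
    · rw [Function.update_of_ne hj] at this
      omega
  | load f q ih =>
    obtain ⟨B, h⟩ := ih
    exact ⟨B, fun v S j => h _ _ j⟩
  | branch f q₁ q₂ ih₁ ih₂ =>
    obtain ⟨B₁, h₁⟩ := ih₁
    obtain ⟨B₂, h₂⟩ := ih₂
    refine ⟨B₁ + B₂, fun v S j => ?_⟩
    have := h₁ v S j
    have := h₂ v S j
    simp only [TM2.stepAux]
    cases f v <;> simp only [cond_true, cond_false] <;> omega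
  | goto f => exact ⟨0, fun v S j => le_rfl⟩
  | halt => exact ⟨0, fun v S j => le_rfl⟩

/-- A machine has to remove its program from the input stack before it halts. -/
theorem exists_length_program_le (U : Machine) :
    ∃ B : ℕ, ∀ ρ τ s, OutputsInTime U ρ τ s → ρ.length ≤ τ.length + B * s := by
  have := U.tm.ΛFin
  choose B hB using fun l => exists_stepAux_length_le (U.tm.m l)
  refine ⟨∑ l, B l, fun ρ τ s h => ?_⟩
  obtain ⟨i, hi, h⟩ := outputsInTime_iff.1 h
  have hrun : ∀ i (c c' : U.tm.Cfg), (fun o => Option.bind o U.tm.step)^[i] (some c) = some c' →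
      ∀ k, (c.stk k).length ≤ (c'.stk k).length + (∑ l, B l) * i := by
    intro i
    induction i with
    | zero => rintro c c' h k; cases h; simp
    | succ i ih =>
      intro c c' h k
      rw [Function.iterate_succ_apply'] at h
      obtain ⟨d, hd, hdc⟩ := Option.bind_eq_some_iff.1 h
      obtain ⟨_ | l, v, S⟩ := d
      · cases hdc
      · cases hdc
        have h1 := ih _ _ hd k
        have h2 := hB l v S k
        have h3 : B l ≤ ∑ l, B l := Finset.single_le_sum (fun _ _ => Nat.zero_le _)
          (Finset.mem_univ l)
        dsimp only at h1
        rw [mul_add, mul_one]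
        omega
  have h0 := hrun i _ _ h U.tm.k₀
  rw [initList_stk, haltList_stk, Function.update_self, List.length_map] at h0
  -- At the end the input stack is empty unless it is also the output stack, in which case it holds
  -- `τ`.
  have h1 : (Function.update (fun _ => []) U.tm.k₁ (τ.map U.outputAlphabet.symm) U.tm.k₀ :
      List (U.tm.Γ U.tm.k₀)).length ≤ τ.length := by
    generalize U.tm.k₀ = k
    rcases eq_or_ne k U.tm.k₁ with rfl | hk
    · simp
    · simp [hk]
  have h2 : (∑ l, B l) * i ≤ (∑ l, B l) * s := Nat.mul_le_mul_left _ (Nat.le_of_lt_succ hi)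
  omega

/-! ### Computability of bounded sums and quantifiers -/

section Computability

variable {α β : Type*} [Primcodable α] [Primcodable β]

theorem computable_sum_range {f : α → ℕ → ℕ} {b : α → ℕ} (hf : Computable₂ f)
    (hb : Computable b) : Computable fun a => ∑ i ∈ Finset.range (b a), f a i := by
  have h : Computable₂ fun (a : α) (p : ℕ × ℕ) => p.2 + f a p.1 :=
    Primrec.nat_add.to_comp.comp (Computable.snd.comp Computable.snd)
      (hf.comp Computable.fst (Computable.fst.comp Computable.snd))
  refine (Computable.nat_rec hb (Computable.const 0) h).of_eq fun a => ?_
  induction b a with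
  | zero => rfl
  | succ n ih => simp only [Finset.sum_range_succ, ← ih]

theorem _root_.ComputablePred.comp {p : β → Prop} (hp : ComputablePred p) {f : α → β}
    (hf : Computable f) : ComputablePred fun a => p (f a) :=
  let ⟨_, h⟩ := hp
  ⟨inferInstance, h.comp hf⟩

theorem _root_.ComputablePred.and {p q : α → Prop} (hp : ComputablePred p) (hq : ComputablePred q) :
    ComputablePred fun a => p a ∧ q a :=
  let ⟨_, h⟩ := hp
  let ⟨_, h'⟩ := hq
  ⟨inferInstance, (Primrec.and.to_comp.comp h h').of_eq fun a => by simp⟩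

theorem computable_ite {p : α → Prop} [DecidablePred p] (hp : ComputablePred p) {f g : α → β}
    (hf : Computable f) (hg : Computable g) : Computable fun a => if p a then f a else g a :=
  let ⟨_, h⟩ := hp
  (Computable.cond h hf hg).of_eq fun a => by by_cases h : p a <;> simp [h]

theorem computablePred_le {f g : α → ℕ} (hf : Computable f) (hg : Computable g) :
    ComputablePred fun a => f a ≤ g a :=
  Primrec.nat_le.computablePred.comp (hf.pair hg)

theorem computablePred_eq [DecidableEq β] {f g : α → β} (hf : Computable f) (hg : Computable g) :
    ComputablePred fun a => f a = g a :=
  Primrec.eq.computablePred.comp (hf.pair hg)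

theorem _root_.ComputablePred.exists_lt {p : α → ℕ → Prop} (hp : ComputablePred fun x : α × ℕ => p x.1 x.2)
    {b : α → ℕ} (hb : Computable b) : ComputablePred fun a => ∃ i < b a, p a i := by
  classical
  have h : Computable₂ fun a i => if p a i then 1 else 0 :=
    computable_ite hp (Computable.const 1) (Computable.const 0)
  refine (computablePred_le (Computable.const 1) (computable_sum_range h hb)).of_eq fun a => ?_
  simp [Nat.one_le_iff_ne_zero]

theorem _root_.ComputablePred.forall_lt {p : α → ℕ → Prop} (hp : ComputablePred fun x : α × ℕ => p x.1 x.2)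
    {b : α → ℕ} (hb : Computable b) : ComputablePred fun a => ∀ i < b a, p a i :=
  (ComputablePred.exists_lt (p := fun a i => ¬ p a i) hp.not hb).not.of_eq fun a => by simp

theorem computable_pow {f g : α → ℕ} (hf : Computable f) (hg : Computable g) :
    Computable fun a => f a ^ g a :=
  (Primrec₂.unpaired'.1 Nat.Primrec.pow).to_comp.comp hf hg

/-- The stages of an enumeration of a computably enumerable set. -/
theorem exists_computable_stages {p : α → Prop} (hp : REPred p) :
    ∃ A : α → ℕ → Prop, ComputablePred (fun x : α × ℕ => A x.1 x.2) ∧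
      (∀ a, Monotone (A a)) ∧ ∀ a, p a ↔ ∃ s, A a s := by
  obtain ⟨c, hc⟩ := Nat.Partrec.Code.exists_code.1 hp
  refine ⟨fun a s => ((c.evaln s (Encodable.encode a)).isSome : Prop), ?_, ?_, fun a => ?_⟩
  · refine Computable.computablePred (p := fun x : α × ℕ =>
      ((c.evaln x.2 (Encodable.encode x.1)).isSome : Prop)) ?_
    have : Computable fun x : α × ℕ => (c.evaln x.2 (Encodable.encode x.1)).isSome :=
      Primrec.option_isSome.to_comp.comp (Nat.Partrec.Code.primrec_evaln.to_comp.comp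
        ((Computable.snd.pair (Computable.const c)).pair
          (Computable.encode.comp Computable.fst)))
    simpa using this
  · intro a s s' hs h
    obtain ⟨x, hx⟩ := Option.isSome_iff_exists.1 h
    exact Option.isSome_iff_exists.2 ⟨x, Nat.Partrec.Code.evaln_mono hs hx⟩
  · have h1 : p a ↔ (c.eval (Encodable.encode a)).Dom := by
      rw [hc]; simp [Part.assert]
    rw [h1, Part.dom_iff_mem]
    simp only [Nat.Partrec.Code.evaln_complete, Option.isSome_iff_exists]
    exact exists_comm

end Computability

/-! ### Numbering of strings in order of length -/

/-- The number of a string in an enumeration of all strings that respects the length. -/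
def stringIndex : List Bool → ℕ
  | [] => 0
  | b :: l => 2 * stringIndex l + (1 + b.toNat)

theorem stringIndex_injective : Function.Injective stringIndex := by
  intro σ
  induction σ with
  | nil =>
    rintro (_ | ⟨b, τ⟩) h
    · rfl
    · simp only [stringIndex] at h; omega
  | cons a σ ih =>
    rintro (_ | ⟨b, τ⟩) h
    · simp [stringIndex] at h
    · cases a <;> cases b <;> simp [stringIndex] at h <;> first | omega | skip
      · rw [ih h]
      · rw [ih h]

theorem stringIndex_surjective : Function.Surjective stringIndex := by
  intro n
  induction n using Nat.strong_induction_on with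
  | _ n ih =>
    rcases n with _ | n
    · exact ⟨[], rfl⟩
    · obtain ⟨σ, hσ⟩ := ih (n / 2) (by omega)
      refine ⟨decide (n % 2 = 1) :: σ, ?_⟩
      rcases Nat.mod_two_eq_zero_or_one n with h | h <;> simp [stringIndex, hσ, h] <;> omega

/-- The enumeration of all strings in order of length. -/
noncomputable def stringOf : ℕ ≃ List Bool :=
  (Equiv.ofBijective stringIndex ⟨stringIndex_injective, stringIndex_surjective⟩).symm

/-- The index is a base-two numeral with digits `1` and `2`, so the strings of length `m` occupy
exactly the interval from `2 ^ m - 1` to `2 ^ (m + 1) - 2`. -/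
theorem stringIndex_bounds (σ : List Bool) :
    2 ^ σ.length ≤ stringIndex σ + 1 ∧ stringIndex σ + 1 < 2 ^ (σ.length + 1) := by
  induction σ with
  | nil => simp [stringIndex]
  | cons b σ ih =>
    cases b <;> simp only [stringIndex, List.length_cons, Bool.toNat_true, Bool.toNat_false] <;>
      omega

theorem stringIndex_stringOf (n : ℕ) : stringIndex (stringOf n) = n :=
  stringOf.symm_apply_apply n

theorem stringOf_stringIndex (σ : List Bool) : stringOf (stringIndex σ) = σ :=
  stringOf.apply_symm_apply σ

theorem length_stringOf_le (n : ℕ) : (stringOf n).length ≤ n := by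
  have h := (stringIndex_bounds (stringOf n)).1
  rw [stringIndex_stringOf] at h
  have := Nat.lt_two_pow_self (n := (stringOf n).length)
  omega

theorem stringIndex_lt {σ : List Bool} {n : ℕ} (h : σ.length ≤ n) : stringIndex σ < 2 ^ (n + 1) :=
  have := (stringIndex_bounds σ).2
  have := Nat.pow_le_pow_right two_pos (Nat.succ_le_succ h)
  by omega

theorem computable_stringOf : Computable stringOf := by
  have hidx : Primrec stringIndex := by
    have : Primrec₂ fun (_ : List Bool) (p : Bool × ℕ) => 2 * p.2 + (1 + p.1.toNat) :=
      Primrec.nat_add.comp (Primrec.nat_mul.comp (Primrec.const 2)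
        (Primrec.snd.comp Primrec.snd)) ((Primrec.dom_finite fun b : Bool => 1 + b.toNat).comp
          (Primrec.fst.comp Primrec.snd))
    refine (Primrec.list_foldr Primrec.id (Primrec.const 0) this).of_eq fun σ => ?_
    induction σ with
    | nil => rfl
    | cons b σ ih => simp only [id, List.foldr_cons, stringIndex] at ih ⊢; rw [ih]
  have h : ∀ n, ∃ c, (Encodable.decode c : Option (List Bool)).map stringIndex = some n := fun n =>
    ⟨Encodable.encode (stringOf n), by simp [stringIndex_stringOf]⟩
  have hfind := Computable.find (P := fun n c =>
    (Encodable.decode c : Option (List Bool)).map stringIndex = some n)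
    (computablePred_eq (Primrec.option_map (Primrec.decode.comp Primrec.snd)
      (hidx.comp₂ Primrec₂.right)).to_comp (Computable.option_some.comp Computable.fst)) h
  -- The default `[]` is never used, since the code found by the search decodes.
  refine (Computable.option_getD (Computable.decode.comp hfind) (Computable.const [])).of_eq
    fun n => ?_
  obtain ⟨σ, hσ, hn⟩ := Option.map_eq_some_iff.1 (Nat.find_spec (h n))
  rw [hσ, ← hn, stringOf_stringIndex]
  rfl

/-! ### The Kraft inequality and its converse -/

theorem PrefixFree.mono {D D' : Set (List Bool)} (h : PrefixFree D) (hD : D' ⊆ D) :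
    PrefixFree D' :=
  fun σ hσ ρ hρ => h σ (hD hσ) ρ (hD hρ)

theorem PrefixFree.uniquelyDecodable {D : Set (List Bool)} (h : PrefixFree D) (hD : [] ∉ D) :
    InformationTheory.UniquelyDecodable D := by
  intro L₁
  induction L₁ with
  | nil =>
    rintro (_ | ⟨w, L₂⟩) - h₂ hflat
    · rfl
    · have hw : w = [] := by
        simp only [List.flatten_nil, List.flatten_cons] at hflat
        exact (List.append_eq_nil_iff.1 hflat.symm).1
      exact absurd (hw ▸ h₂ w (by simp)) hD
  | cons v L₁ ih =>
    rintro (_ | ⟨w, L₂⟩) h₁ h₂ hflat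
    · have hv : v = [] := by
        simp only [List.flatten_nil, List.flatten_cons] at hflat
        exact (List.append_eq_nil_iff.1 hflat).1
      exact absurd (hv ▸ h₁ v (by simp)) hD
    · simp only [List.flatten_cons] at hflat
      have hv := h₁ v (by simp)
      have hw := h₂ w (by simp)
      have hvw : v = w := by
        have hp : v <+: w ++ L₂.flatten := hflat ▸ List.prefix_append v _
        rcases List.prefix_or_prefix_of_prefix hp (List.prefix_append w _) with h' | h'
        · exact h _ hv _ hw h'
        · exact (h _ hw _ hv h').symm
      subst hvw
      rw [ih L₂ (fun u hu => h₁ u (by simp [hu])) (fun u hu => h₂ u (by simp [hu]))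
        (List.append_cancel_left hflat)]

theorem PrefixFree.kraft_inequality {S : Finset (List Bool)}
    (h : PrefixFree (S : Set (List Bool))) : ∑ σ ∈ S, (2 : ℝ)⁻¹ ^ σ.length ≤ 1 := by
  -- An empty codeword destroys unique decodability, but then it is the only codeword.
  by_cases hS : [] ∈ S
  · have : S = {[]} := by
      refine Finset.eq_singleton_iff_unique_mem.2 ⟨hS, fun σ hσ => ?_⟩
      exact (h [] hS σ hσ List.nil_prefix).symm
    simp [this]
  · simpa using InformationTheory.kraft_mcmillan_inequality (h.uniquelyDecodable hS)

/-- The number with the given binary digits, most significant digit first. -/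
def binaryValue (σ : List Bool) : ℕ :=
  σ.foldl (fun x b => 2 * x + b.toNat) 0

theorem binaryValue_concat (σ : List Bool) (b : Bool) :
    binaryValue (σ ++ [b]) = 2 * binaryValue σ + b.toNat := by
  simp [binaryValue]

/-- The dyadic interval of an extension of `σ` lies inside that of `σ`, the interval of `σ` being
`[v, v + 1] / 2 ^ |σ|` with `v = binaryValue σ`. -/
theorem binaryValue_append (σ τ : List Bool) : binaryValue σ * 2 ^ τ.length ≤ binaryValue (σ ++ τ) ∧
    binaryValue (σ ++ τ) + 1 ≤ (binaryValue σ + 1) * 2 ^ τ.length := by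
  induction τ using List.reverseRecOn with
  | nil => simp
  | append_singleton τ b ih =>
    rw [← List.append_assoc, binaryValue_concat, List.length_append, List.length_singleton,
      pow_succ, ← mul_assoc, ← mul_assoc]
    cases b <;> simp only [Bool.toNat_true, Bool.toNat_false] <;> omega

theorem exists_binaryValue_eq {m a : ℕ} (h : a < 2 ^ m) :
    ∃ σ : List Bool, σ.length = m ∧ binaryValue σ = a := by
  induction m generalizing a with
  | zero => exact ⟨[], rfl, by simp at h; simp [h, binaryValue]⟩
  | succ m ih =>
    obtain ⟨σ, hσ, hv⟩ := ih (a := a / 2) (by rw [pow_succ] at h; omega)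
    refine ⟨σ ++ [decide (a % 2 = 1)], by simp [hσ], ?_⟩
    rw [binaryValue_concat, hv]
    rcases Nat.mod_two_eq_zero_or_one a with h | h <;> simp [h] <;> omega

theorem computable_binaryValue : Computable binaryValue := by
  have : Primrec₂ fun (_ : List Bool) (p : ℕ × Bool) => 2 * p.1 + p.2.toNat :=
    Primrec.nat_add.comp (Primrec.nat_mul.comp (Primrec.const 2) (Primrec.fst.comp Primrec.snd))
      ((Primrec.dom_finite Bool.toNat).comp (Primrec.snd.comp Primrec.snd))
  exact (Primrec.list_foldl Primrec.id (Primrec.const 0) this).to_comp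

section KraftChaitin

variable (D : ℕ → Prop) [DecidablePred D] (l : ℕ → ℕ)

/-- The total weight of the first `n` requests; the request `i` is active if `D i`, and it asks for
a codeword of length `l i`. -/
noncomputable def requestWeight (n : ℕ) : ℝ :=
  ∑ i ∈ Finset.range n, if D i then (2 : ℝ)⁻¹ ^ l i else 0

/-- The string `ρ` serves the request `i`: its length is `l i + 1`, and its dyadic interval lies in
the part of the unit interval that is reserved for the request. -/
def Serves (i : ℕ) (ρ : List Bool) : Prop :=
  D i ∧ ρ.length = l i + 1 ∧ requestWeight D l i ≤ binaryValue ρ / 2 ^ ρ.length ∧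
    (binaryValue ρ + 1 : ℝ) / 2 ^ ρ.length ≤ requestWeight D l (i + 1)

theorem requestWeight_mono : Monotone (requestWeight D l) :=
  monotone_nat_of_le_succ fun n => by
    rw [requestWeight, requestWeight, Finset.sum_range_succ]
    exact le_add_of_nonneg_right (by split_ifs <;> positivity)

variable {D l}

/-- The interval of `ρ` lies in that of `σ`, hence in the reserved parts of both requests; parts of
different requests do not overlap. -/
theorem Serves.eq_of_prefix {i j : ℕ} {σ ρ : List Bool} (hi : Serves D l i σ) (hj : Serves D l j ρ)
    (h : σ <+: ρ) : i = j ∧ σ = ρ := by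
  obtain ⟨-, hli, hi₁, hi₂⟩ := hi
  obtain ⟨-, hlj, hj₁, hj₂⟩ := hj
  obtain ⟨τ, rfl⟩ := h
  obtain ⟨h₁, h₂⟩ := binaryValue_append σ τ
  have h₁' : (binaryValue σ : ℝ) * 2 ^ τ.length ≤ binaryValue (σ ++ τ) := mod_cast h₁
  have h₂' : (binaryValue (σ ++ τ) : ℝ) + 1 ≤ (binaryValue σ + 1) * 2 ^ τ.length := mod_cast h₂
  have hpos : ∀ n : ℕ, (0 : ℝ) < 2 ^ n := fun n => by positivity
  rw [List.length_append, pow_add] at hj₁ hj₂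
  have hlow : (binaryValue σ : ℝ) / 2 ^ σ.length ≤
      binaryValue (σ ++ τ) / (2 ^ σ.length * 2 ^ τ.length) := by
    rw [div_le_div_iff₀ (hpos _) (mul_pos (hpos _) (hpos _))]
    nlinarith [mul_le_mul_of_nonneg_right h₁' (hpos σ.length).le]
  have hhigh : ((binaryValue (σ ++ τ) : ℝ) + 1) / (2 ^ σ.length * 2 ^ τ.length) ≤
      (binaryValue σ + 1) / 2 ^ σ.length := by
    rw [div_le_div_iff₀ (mul_pos (hpos _) (hpos _)) (hpos _)]
    nlinarith [mul_le_mul_of_nonneg_right h₂' (hpos σ.length).le]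
  have hlt : (binaryValue (σ ++ τ) : ℝ) / (2 ^ σ.length * 2 ^ τ.length) <
      (binaryValue (σ ++ τ) + 1) / (2 ^ σ.length * 2 ^ τ.length) :=
    div_lt_div_of_pos_right (lt_add_one _) (mul_pos (hpos _) (hpos _))
  have hij : i = j := by
    rcases lt_trichotomy i j with h | h | h
    · linarith [requestWeight_mono D l (Nat.succ_le_of_lt h)]
    · exact h
    · linarith [requestWeight_mono D l (Nat.succ_le_of_lt h)]
  subst hij
  refine ⟨rfl, ?_⟩
  rw [List.length_append] at hlj
  simp [List.length_eq_zero_iff.1 (by omega : τ.length = 0)]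

/-- The reserved interval need not have dyadic alignment, but it is twice as long as the dyadic
interval sought, so rounding its left end up leaves enough room. This is why codewords have one
extra bit. -/
theorem exists_serves (hsum : ∀ n, requestWeight D l n ≤ 1) {i : ℕ} (hi : D i) :
    ∃ ρ, Serves D l i ρ := by
  have hpos : (0 : ℝ) < 2 ^ (l i + 1) := by positivity
  have hw : requestWeight D l (i + 1) = requestWeight D l i + 2 / 2 ^ (l i + 1) := by
    rw [requestWeight, Finset.sum_range_succ, if_pos hi, requestWeight, pow_succ, inv_pow]
    field_simp
  have h0 : 0 ≤ requestWeight D l i := Finset.sum_nonneg fun _ _ => by split_ifs <;> positivity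
  have hceil := Nat.ceil_lt_add_one (mul_nonneg h0 hpos.le)
  have hle := Nat.le_ceil (requestWeight D l i * 2 ^ (l i + 1))
  have hmul : requestWeight D l (i + 1) * 2 ^ (l i + 1) =
      requestWeight D l i * 2 ^ (l i + 1) + 2 := by
    rw [hw, add_mul, div_mul_cancel₀ _ hpos.ne']
  have hone : requestWeight D l (i + 1) * 2 ^ (l i + 1) ≤ 2 ^ (l i + 1) :=
    mul_le_of_le_one_left hpos.le (hsum _)
  obtain ⟨ρ, hρ, hv⟩ := exists_binaryValue_eq (m := l i + 1)
    (a := ⌈requestWeight D l i * 2 ^ (l i + 1)⌉₊) (by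
      have : (⌈requestWeight D l i * 2 ^ (l i + 1)⌉₊ : ℝ) < 2 ^ (l i + 1) := by linarith
      exact_mod_cast this)
  refine ⟨ρ, hi, hρ, ?_, ?_⟩
  · rw [hρ, hv, le_div_iff₀ hpos]
    exact hle
  · rw [hρ, hv, div_le_iff₀ hpos]
    linarith

theorem computablePred_serves (hD : ComputablePred D) (hl : Computable l) :
    ComputablePred fun p : List Bool × ℕ => Serves D l p.2 p.1 := by
  -- `2 ^ L i` is a common denominator of the weights up to request `i`, which turns the comparisons
  -- of reals into comparisons of naturals.
  let L (i : ℕ) : ℕ := ∑ j ∈ Finset.range (i + 1), l j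
  let N (i m : ℕ) : ℕ := ∑ j ∈ Finset.range m, if D j then 2 ^ (L i - l j) else 0
  have hL : Computable L := computable_sum_range (hl.comp Computable.snd).to₂ Computable.succ
  have hN : Computable₂ N := by
    refine computable_sum_range ?_ Computable.snd
    exact computable_ite (hD.comp Computable.snd) (computable_pow (Computable.const 2)
      (Primrec.nat_sub.to_comp.comp (hL.comp (Computable.fst.comp Computable.fst))
        (hl.comp Computable.snd))) (Computable.const 0)
  have hNw : ∀ i m, m ≤ i + 1 → requestWeight D l m = N i m / 2 ^ L i := by
    intro i m hm
    rw [requestWeight, Nat.cast_sum, Finset.sum_div]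
    refine Finset.sum_congr rfl fun j hj => ?_
    split_ifs
    · have : l j ≤ L i := Finset.single_le_sum (f := l) (fun _ _ => Nat.zero_le _)
        (Finset.mem_range.2 ((Finset.mem_range.1 hj).trans_le hm))
      rw [Nat.cast_pow, Nat.cast_ofNat, eq_div_iff (by positivity), inv_pow,
        ← Nat.sub_add_cancel this, pow_add, Nat.add_sub_cancel]
      field_simp
    · simp
  have hlen : Computable fun p : List Bool × ℕ => p.1.length :=
    Computable.list_length.comp Computable.fst
  have hval : Computable fun p : List Bool × ℕ => binaryValue p.1 :=
    computable_binaryValue.comp Computable.fst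
  have hpow : Computable fun p : List Bool × ℕ => 2 ^ p.1.length :=
    computable_pow (Computable.const 2) hlen
  have hpowL : Computable fun p : List Bool × ℕ => 2 ^ L p.2 :=
    computable_pow (Computable.const 2) (hL.comp Computable.snd)
  have hmul : Computable₂ ((· * ·) : ℕ → ℕ → ℕ) := Primrec.nat_mul.to_comp
  have key : ComputablePred fun p : List Bool × ℕ => D p.2 ∧ p.1.length = l p.2 + 1 ∧
      N p.2 p.2 * 2 ^ p.1.length ≤ binaryValue p.1 * 2 ^ L p.2 ∧
      (binaryValue p.1 + 1) * 2 ^ L p.2 ≤ N p.2 (p.2 + 1) * 2 ^ p.1.length := by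
    refine (hD.comp Computable.snd).and ((computablePred_eq hlen
      (Computable.succ.comp (hl.comp Computable.snd))).and ((computablePred_le
        (hmul.comp (hN.comp Computable.snd Computable.snd) hpow) (hmul.comp hval hpowL)).and
        (computablePred_le (hmul.comp (Computable.succ.comp hval) hpowL) (hmul.comp
          (hN.comp Computable.snd (Computable.succ.comp Computable.snd)) hpow))))
  refine key.of_eq fun ⟨ρ, i⟩ => ?_
  refine and_congr_right fun _ => and_congr_right fun _ => ?_
  dsimp only
  rw [hNw i i (Nat.le_succ i), hNw i (i + 1) le_rfl, div_le_div_iff₀ (by positivity)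
    (by positivity), div_le_div_iff₀ (by positivity) (by positivity)]
  norm_cast

/-- The machine existence theorem: a computable sequence of requests of total weight at most one can
be served by a universal prefix-free machine, up to an additive constant. -/
theorem exists_programs {U : Machine} (hU : IsUniversalPrefixFree U) (hD : ComputablePred D)
    (hl : Computable l) {out : ℕ → List Bool} (hout : Computable out)
    (hsum : ∀ n, requestWeight D l n ≤ 1) :
    ∃ c, ∀ i, D i → ∃ ρ : List Bool, ρ.length ≤ l i + c ∧ Outputs U ρ (out i) := by
  classical
  let V : List Bool →. List Bool := fun ρ =>
    (Nat.rfind fun i => Part.some (decide (Serves D l i ρ))).map out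
  have hserves : ∀ ρ i, i ∈ (Nat.rfind fun i => Part.some (decide (Serves D l i ρ))) →
      Serves D l i ρ := fun ρ i h => by simpa using Nat.rfind_spec h
  have hV : Partrec V := Partrec.map
    (Partrec.rfind (computablePred_serves hD hl).decide.partrec) (hout.comp Computable.snd)
  have hdom : ∀ ρ, (V ρ).Dom → ∃ i, Serves D l i ρ := fun ρ h => by
    obtain ⟨i, hi⟩ := Part.dom_iff_mem.1 (show (Nat.rfind _).Dom from h)
    exact ⟨i, hserves ρ i hi⟩
  obtain ⟨c, hc⟩ := hU.universal V hV fun σ hσ ρ hρ h => by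
    obtain ⟨i, hi⟩ := hdom σ hσ
    obtain ⟨j, hj⟩ := hdom ρ hρ
    exact (hi.eq_of_prefix hj h).2
  refine ⟨1 + c, fun i hi => ?_⟩
  obtain ⟨ρ, hρ⟩ := exists_serves hsum hi
  obtain ⟨j, hj, -⟩ := Nat.rfind_min' (p := fun i => decide (Serves D l i ρ)) (m := i)
    (by simpa using hρ)
  obtain rfl : i = j := (hρ.eq_of_prefix (hserves ρ j hj) List.prefix_rfl).1
  obtain ⟨π, hπ, hout⟩ := hc ρ (out i) (Part.mem_map out hj)
  exact ⟨π, by rw [hρ.2.1] at hπ; omega, hout⟩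

end KraftChaitin

/-! ### The semimeasure induced by a prefix-free machine -/

theorem computablePred_prefix :
    ComputablePred fun p : List Bool × List Bool => p.1 <+: p.2 :=
  (computablePred_eq Computable.fst (Primrec.list_take.to_comp.comp
    (Computable.list_length.comp Computable.fst) Computable.snd)).of_eq
      fun _ => List.prefix_iff_eq_take.symm

/-- The weight of the program with index `p.1`. -/
noncomputable def programWeight (p : ℕ × ℕ) : ℝ :=
  (2 : ℝ)⁻¹ ^ (stringOf p.1).length

theorem programWeight_nonneg (p : ℕ × ℕ) : 0 ≤ programWeight p := by
  unfold programWeight; positivity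

theorem sum_programWeight_le_one {U : Machine} (hU : PrefixFree {σ | ∃ τ, Outputs U σ τ})
    {A : Finset (ℕ × ℕ)} (hA : ∀ p ∈ A, Outputs U (stringOf p.1) (stringOf p.2)) :
    ∑ p ∈ A, programWeight p ≤ 1 := by
  have hinj : Set.InjOn (fun p : ℕ × ℕ => stringOf p.1) (A : Set (ℕ × ℕ)) := by
    rintro ⟨e, d⟩ hp ⟨e', d'⟩ hp' h
    have he : e = e' := stringOf.injective h
    subst he
    exact Prod.ext rfl (stringOf.injective ((hA (e, d) hp).unique (hA (e, d') hp')))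
  have h := PrefixFree.kraft_inequality (S := A.image fun p => stringOf p.1) <| hU.mono <| by
    intro σ hσ
    obtain ⟨p, hp, rfl⟩ := Finset.mem_image.1 (Finset.mem_coe.1 hσ)
    exact ⟨_, hA p hp⟩
  rwa [Finset.sum_image hinj] at h

open Classical in
/-- The total weight of the programs with small index that output an extension of `τ` within `s`
steps. -/
noncomputable def machineStage (U : Machine) (τ : List Bool) (s : ℕ) : ℝ :=
  ∑ p ∈ Finset.range s ×ˢ Finset.range s,
    if OutputsInTime U (stringOf p.1) (stringOf p.2) s ∧ τ <+: stringOf p.2 then programWeight p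
    else 0

/-- The probability that the machine `U` outputs an extension of `τ`. -/
noncomputable def machineSemimeasure (U : Machine) (τ : List Bool) : ℝ :=
  ⨆ s, machineStage U τ s

theorem machineStage_mono (U : Machine) (τ : List Bool) : Monotone (machineStage U τ) := by
  intro s s' h
  refine (Finset.sum_le_sum fun p _ => ?_).trans (Finset.sum_le_sum_of_subset_of_nonneg
    (Finset.product_subset_product (Finset.range_mono h) (Finset.range_mono h))
    fun p _ _ => ?_)
  · by_cases hp : OutputsInTime U (stringOf p.1) (stringOf p.2) s ∧ τ <+: stringOf p.2
    · rw [if_pos hp, if_pos ⟨hp.1.mono h, hp.2⟩]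
    · rw [if_neg hp]
      split_ifs
      exacts [programWeight_nonneg p, le_rfl]
  · split_ifs
    exacts [programWeight_nonneg p, le_rfl]

/-- A program of index below `s` has length at most `s`, so `2 ^ s` is a common denominator. -/
theorem computable_machineStage {U : Machine} (hU : IsUniversalPrefixFree U) :
    ∃ a : List Bool → ℕ → ℕ, Computable₂ a ∧
      ∀ τ s, machineStage U τ s = (a τ s : ℝ) / 2 ^ s := by
  classical
  refine ⟨fun τ s => ∑ e ∈ Finset.range s, ∑ d ∈ Finset.range s,
    if OutputsInTime U (stringOf e) (stringOf d) s ∧ τ <+: stringOf d then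
      2 ^ (s - (stringOf e).length) else 0, ?_, fun τ s => ?_⟩
  · refine computable_sum_range ?_ Computable.snd
    refine computable_sum_range ?_ (Computable.snd.comp Computable.fst)
    have hs : Computable fun x : ((List Bool × ℕ) × ℕ) × ℕ => x.1.1.2 :=
      Computable.snd.comp (Computable.fst.comp Computable.fst)
    have he : Computable fun x : ((List Bool × ℕ) × ℕ) × ℕ => stringOf x.1.2 :=
      computable_stringOf.comp (Computable.snd.comp Computable.fst)
    have hd : Computable fun x : ((List Bool × ℕ) × ℕ) × ℕ => stringOf x.2 :=
      computable_stringOf.comp Computable.snd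
    have hτ : Computable fun x : ((List Bool × ℕ) × ℕ) × ℕ => x.1.1.1 :=
      Computable.fst.comp (Computable.fst.comp Computable.fst)
    exact computable_ite
      (((primrecPred_outputsInTime U hU.finite_alphabet).computablePred.comp
        ((he.pair hd).pair hs)).and (computablePred_prefix.comp (hτ.pair hd)))
      (computable_pow (Computable.const 2)
        (Primrec.nat_sub.to_comp.comp hs (Computable.list_length.comp he))) (Computable.const 0)
  · rw [machineStage, Finset.sum_product, Nat.cast_sum, Finset.sum_div]
    refine Finset.sum_congr rfl fun e he => ?_
    rw [Nat.cast_sum, Finset.sum_div]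
    refine Finset.sum_congr rfl fun d _ => ?_
    split_ifs
    · have : (stringOf e).length ≤ s :=
        (length_stringOf_le e).trans (Finset.mem_range.1 he).le
      rw [programWeight, Nat.cast_pow, Nat.cast_ofNat, eq_div_iff (by positivity), inv_pow]
      nth_rewrite 1 [← Nat.sub_add_cancel this]
      rw [pow_add]
      field_simp
    · simp

variable {U : Machine}

theorem machineStage_le_one (hU : IsUniversalPrefixFree U) (τ : List Bool) (s : ℕ) : machineStage U τ s ≤ 1 := by
  classical
  rw [machineStage, ← Finset.sum_filter]
  refine sum_programWeight_le_one hU.prefixFree fun p hp => ?_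
  exact outputs_iff.2 ⟨s, (Finset.mem_filter.1 hp).2.1⟩

theorem tendsto_machineStage (hU : IsUniversalPrefixFree U) (τ : List Bool) :
    Tendsto (machineStage U τ) atTop (𝓝 (machineSemimeasure U τ)) :=
  tendsto_atTop_ciSup (machineStage_mono U τ)
    ⟨1, Set.forall_mem_range.2 fun s => machineStage_le_one hU τ s⟩

theorem machineStage_le (hU : IsUniversalPrefixFree U) (τ : List Bool) (s : ℕ) :
    machineStage U τ s ≤ machineSemimeasure U τ :=
  (machineStage_mono U τ).ge_of_tendsto (tendsto_machineStage hU τ) s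

theorem isContinuousSemimeasure_machineSemimeasure (hU : IsUniversalPrefixFree U) :
    IsContinuousSemimeasure (machineSemimeasure U) where
  nonneg τ := by simpa [machineStage] using machineStage_le hU τ 0
  root_le_one := le_of_tendsto' (tendsto_machineStage hU []) (machineStage_le_one hU [])
  -- No output extends both `τ0` and `τ1`; equality may fail because the output `τ` itself extends
  -- neither.
  superadditive τ := by
    refine le_of_tendsto_of_tendsto' ((tendsto_machineStage hU _).add (tendsto_machineStage hU _))
      (tendsto_machineStage hU τ) fun s => ?_
    simp only [machineStage, ← Finset.sum_add_distrib]
    refine Finset.sum_le_sum fun p _ => ?_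
    have hw := programWeight_nonneg p
    have hsub : ∀ b, τ ++ [b] <+: stringOf p.2 → τ <+: stringOf p.2 := fun b h =>
      (List.prefix_append τ [b]).trans h
    have hdisj : τ ++ [false] <+: stringOf p.2 → ¬ τ ++ [true] <+: stringOf p.2 := by
      intro h h'
      simpa using (List.prefix_of_prefix_length_le h h' (by simp)).eq_of_length (by simp)
    have hf := hsub false
    have ht := hsub true
    split_ifs <;> first | linarith | (exfalso; tauto)

theorem lowerSemicomputable_machineSemimeasure (hU : IsUniversalPrefixFree U) :
    LowerSemicomputable (machineSemimeasure U) := by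
  obtain ⟨a, ha, h⟩ := computable_machineStage hU
  refine ⟨a, fun _ s => 2 ^ s - 1, ha, Primrec.nat_sub.to_comp.comp
    (computable_pow (Computable.const 2) Computable.snd) (Computable.const 1), fun τ => ?_⟩
  have heq : (fun s => (a τ s : ℝ) / (((2 ^ s - 1 : ℕ) : ℝ) + 1)) = machineStage U τ := by
    funext s
    rw [h, Nat.cast_sub Nat.one_le_two_pow]
    simp
  rw [heq]
  exact ⟨machineStage_mono U τ, tendsto_machineStage hU τ⟩

theorem sum_programWeight_le_machineSemimeasure (hU : IsUniversalPrefixFree U) {A : Finset (ℕ × ℕ)} {τ : List Bool}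
    (hA : ∀ p ∈ A, Outputs U (stringOf p.1) (stringOf p.2) ∧ τ <+: stringOf p.2) :
    ∑ p ∈ A, programWeight p ≤ machineSemimeasure U τ := by
  classical
  have hs : ∀ p ∈ A, ∀ᶠ s in atTop, p ∈ Finset.range s ×ˢ Finset.range s ∧
      OutputsInTime U (stringOf p.1) (stringOf p.2) s := by
    intro p hp
    obtain ⟨s, hs⟩ := outputs_iff.1 (hA p hp).1
    filter_upwards [eventually_ge_atTop s, eventually_gt_atTop p.1, eventually_gt_atTop p.2]
      with s' h₀ h₁ h₂
    exact ⟨by simp [h₁, h₂], hs.mono h₀⟩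
  obtain ⟨s, hs⟩ := ((Filter.eventually_all_finset A).2 hs).exists
  refine le_trans ?_ (machineStage_le hU τ s)
  rw [machineStage, ← Finset.sum_filter]
  exact Finset.sum_le_sum_of_subset_of_nonneg
    (fun p hp => Finset.mem_filter.2 ⟨(hs p hp).1, (hs p hp).2, (hA p hp).2⟩)
    fun p _ _ => programWeight_nonneg p

/-- The programs whose outputs extend strings in a finite set `T` have a total weight that is
bounded by the measure of `T`, for every universal semimeasure. -/
theorem exists_sum_programWeight_le (hU : IsUniversalPrefixFree U) {M : List Bool → ℝ} (hM : IsUniversalSemimeasure M) :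
    ∃ C : ℕ, ∀ (A : Finset (ℕ × ℕ)) (T : Finset (List Bool)) (m : ℕ),
      (∀ p ∈ A, Outputs U (stringOf p.1) (stringOf p.2) ∧ (stringOf p.2).take m ∈ T) →
      ∑ p ∈ A, programWeight p ≤ 2 ^ C * ∑ τ ∈ T, M τ := by
  obtain ⟨c, hc⟩ := hM.dominates _ (isContinuousSemimeasure_machineSemimeasure hU)
    (lowerSemicomputable_machineSemimeasure hU)
  obtain ⟨C, hC⟩ := pow_unbounded_of_one_lt c one_lt_two
  refine ⟨C, fun A T m hA => ?_⟩
  -- The programs are grouped by the element of `T` that their outputs extend.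
  rw [← Finset.sum_fiberwise_of_maps_to (fun p hp => (hA p hp).2), Finset.mul_sum]
  refine Finset.sum_le_sum fun τ _ => ?_
  refine (sum_programWeight_le_machineSemimeasure hU (τ := τ) fun p hp => ?_).trans
    ((hc τ).trans (mul_le_mul_of_nonneg_right hC.le (hM.semimeasure.nonneg τ)))
  obtain ⟨hpA, rfl⟩ := Finset.mem_filter.1 hp
  exact ⟨(hA p hpA).1, List.take_prefix _ _⟩

/-! ### Computable approximations of the canonical tree -/

theorem length_initSeg (X : ℕ → Bool) (n : ℕ) : (initSeg X n).length = n :=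
  List.length_ofFn

theorem initSeg_eq_iff {X Y : ℕ → Bool} {n : ℕ} :
    initSeg X n = initSeg Y n ↔ ∀ i < n, X i = Y i := by
  rw [initSeg, initSeg, List.ofFn_inj, funext_iff]
  exact ⟨fun h i hi => h ⟨i, hi⟩, fun h i => h i i.2⟩

theorem take_initSeg (X : ℕ → Bool) {m n : ℕ} (h : m ≤ n) :
    (initSeg X n).take m = initSeg X m := by
  refine List.ext_getElem (by simp [length_initSeg, h]) fun i h₁ h₂ => ?_
  simp [initSeg]

theorem initSeg_getD (σ : List Bool) {n : ℕ} (h : n ≤ σ.length) :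
    initSeg (fun i => σ.getD i false) n = σ.take n := by
  refine List.ext_getElem (by simp [length_initSeg, h]) fun i h₁ h₂ => ?_
  rw [length_initSeg] at h₁
  simp [initSeg, List.getElem?_eq_getElem (h₁.trans_le h)]

/-- With respect to the set of strings enumerated by `A`, the string `σ` has at stage `s` an
extension of length `σ.length + s` with no prefix that is already enumerated. -/
def AliveAt (A : List Bool → ℕ → Prop) (σ : List Bool) (s : ℕ) : Prop :=
  ∃ τ : List Bool, τ.length = σ.length + s ∧ σ <+: τ ∧ ∀ i ≤ τ.length, ¬ A (τ.take i) s

theorem computablePred_aliveAt {A : List Bool → ℕ → Prop}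
    (hA : ComputablePred fun p : List Bool × ℕ => A p.1 p.2) :
    ComputablePred fun p : List Bool × ℕ => AliveAt A p.1 p.2 := by
  have hlen : Computable fun x : List Bool × ℕ => x.1.length + x.2 :=
    Primrec.nat_add.to_comp.comp (Computable.list_length.comp Computable.fst) Computable.snd
  have hstr : Computable fun x : (List Bool × ℕ) × ℕ => stringOf x.2 :=
    computable_stringOf.comp Computable.snd
  have hall : ComputablePred fun x : (List Bool × ℕ) × ℕ =>
      ∀ i < (stringOf x.2).length + 1, ¬ A ((stringOf x.2).take i) x.1.2 := by
    refine ComputablePred.forall_lt (p := fun (x : (List Bool × ℕ) × ℕ) i =>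
      ¬ A ((stringOf x.2).take i) x.1.2) ?_
      (Computable.succ.comp (Computable.list_length.comp hstr))
    exact (hA.comp ((Primrec.list_take.to_comp.comp Computable.snd
      (hstr.comp Computable.fst)).pair (Computable.snd.comp (Computable.fst.comp
        Computable.fst)))).not
  refine (ComputablePred.exists_lt (b := fun x : List Bool × ℕ => 2 ^ (x.1.length + x.2 + 1))
    (p := fun x e => (stringOf e).length = x.1.length + x.2 ∧ x.1 <+: stringOf e ∧
      ∀ i < (stringOf e).length + 1, ¬ A ((stringOf e).take i) x.2) ?_
    (computable_pow (Computable.const 2) (Computable.succ.comp hlen))).of_eq ?_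
  · exact (computablePred_eq (Computable.list_length.comp hstr)
      (hlen.comp Computable.fst)).and ((computablePred_prefix.comp
        ((Computable.fst.comp Computable.fst).pair hstr)).and hall)
  · rintro ⟨σ, s⟩
    constructor
    · rintro ⟨e, -, h₁, h₂, h₃⟩
      exact ⟨_, h₁, h₂, fun i hi => h₃ i (Nat.lt_succ_of_le hi)⟩
    · rintro ⟨τ, h₁, h₂, h₃⟩
      refine ⟨stringIndex τ, stringIndex_lt h₁.le, ?_⟩
      rw [stringOf_stringIndex]
      exact ⟨h₁, h₂, fun i hi => h₃ i (Nat.le_of_lt_succ hi)⟩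

/-- Truncating a witness for the later stage gives one for the earlier stage, so a string once dead
stays dead. -/
theorem AliveAt.mono {A : List Bool → ℕ → Prop} (hA : ∀ σ, Monotone (A σ)) {σ : List Bool}
    {s s' : ℕ} (hs : s ≤ s') (h : AliveAt A σ s') : AliveAt A σ s := by
  obtain ⟨τ, h₁, h₂, h₃⟩ := h
  refine ⟨τ.take (σ.length + s), by simp; omega, ?_, fun i hi hi' => ?_⟩
  · exact List.prefix_take_iff.2 ⟨h₂, by omega⟩
  · simp only [List.length_take] at hi
    rw [List.take_take, min_eq_left (by omega)] at hi'
    exact h₃ i (by omega) (hA _ hs hi')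

theorem aliveAt_initSeg {W : List Bool → Prop} {A : List Bool → ℕ → Prop}
    (hW : ∀ σ, W σ ↔ ∃ s, A σ s) {X : ℕ → Bool} (hX : ∀ n, ¬ W (initSeg X n)) (n s : ℕ) :
    AliveAt A (initSeg X n) s := by
  refine ⟨initSeg X (n + s), by simp [length_initSeg], ?_, fun i hi h => hX i ?_⟩
  · rw [← take_initSeg X (Nat.le_add_right n s)]
    exact List.take_prefix _ _
  · rw [length_initSeg] at hi
    rw [take_initSeg X hi] at h
    exact (hW _).2 ⟨s, h⟩

/-- Compactness of Cantor space: a cluster point of the witnesses, padded with `false`, avoids `W`.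
An enumerated initial segment of it would be a prefix of some later witness. -/
theorem exists_initSeg_of_aliveAt {W : List Bool → Prop} {A : List Bool → ℕ → Prop}
    (hA : ∀ σ, Monotone (A σ)) (hW : ∀ σ, W σ ↔ ∃ s, A σ s) {σ : List Bool}
    (h : ∀ s, AliveAt A σ s) : ∃ X, (∀ n, ¬ W (initSeg X n)) ∧ σ = initSeg X σ.length := by
  choose τ hlen hσ hτ using h
  let Y (s i : ℕ) : Bool := (τ s).getD i false
  obtain ⟨X, hX⟩ := exists_clusterPt_of_compactSpace (map Y atTop)
  have hfreq : ∀ n, ∃ᶠ s in atTop, initSeg (Y s) n = initSeg X n := by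
    intro n
    have hn : ∀ᶠ Z in 𝓝 X, initSeg Z n = initSeg X n := by
      have : ∀ᶠ Z in 𝓝 X, ∀ i ∈ Finset.range n, Z i = X i :=
        (Filter.eventually_all_finset _).2 fun i _ =>
          ((isOpen_discrete {X i}).preimage
            (continuous_apply (A := fun _ : ℕ => Bool) i)).mem_nhds (Set.mem_singleton (X i))
      exact this.mono fun Z hZ => initSeg_eq_iff.2 fun i hi => hZ i (Finset.mem_range.2 hi)
    exact MapClusterPt.frequently hX hn
  refine ⟨X, fun n hn => ?_, ?_⟩
  · obtain ⟨s₀, hs₀⟩ := (hW _).1 hn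
    -- `n ≤ s` makes the witness long enough that its padding is not seen in the first `n` bits.
    obtain ⟨s, hs, hle⟩ := ((hfreq n).and_eventually (eventually_ge_atTop (max s₀ n))).exists
    have hns : n ≤ (τ s).length := by
      rw [hlen]
      exact (le_max_right s₀ n).trans (hle.trans (Nat.le_add_left _ _))
    rw [initSeg_getD _ hns] at hs
    exact hτ s n hns (hs ▸ hA _ ((le_max_left s₀ n).trans hle) hs₀)
  · obtain ⟨s, hs⟩ := (hfreq σ.length).exists
    rw [← hs, initSeg_getD _ (by rw [hlen]; omega)]
    exact List.prefix_iff_eq_take.1 (hσ s)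

theorem finite_treeLevel (P : Set (ℕ → Bool)) (n : ℕ) : (treeLevel P n).Finite :=
  (List.finite_length_eq Bool n).subset fun _ ⟨X, _, h⟩ => h ▸ length_initSeg X n

/-! ### Members of deep classes are order-deep -/

theorem IsOrderDeep.isStronglyDeep {U : Machine} {X : ℕ → Bool} (h : IsOrderDeep U X) :
    IsStronglyDeep U X := by
  obtain ⟨g, -, ⟨hmono, hunb⟩, hg⟩ := h
  intro t ht c
  obtain ⟨n₀, hn₀⟩ := hunb c
  filter_upwards [hg t ht, eventually_ge_atTop n₀] with n hn hle
  exact le_trans (by gcongr; exact_mod_cast hn₀.trans (hmono hle)) hn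

/-- The least level at which the order `h` reaches `2 * k`. -/
noncomputable def blockStart {h : ℕ → ℕ} (hh : IsOrder h) (k : ℕ) : ℕ :=
  Nat.find (hh.2 (2 * k))

theorem computable_blockStart {h : ℕ → ℕ} (hh : IsOrder h) (hc : Computable h) :
    Computable (blockStart hh) :=
  Computable.find (P := fun k n => 2 * k ≤ h n) (computablePred_le
    (Primrec.nat_mul.to_comp.comp (Computable.const 2) Computable.fst)
    (hc.comp Computable.snd)) fun k => hh.2 (2 * k)

theorem two_mul_le_blockStart {h : ℕ → ℕ} (hh : IsOrder h) (k : ℕ) :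
    2 * k ≤ h (blockStart hh k) :=
  Nat.find_spec (hh.2 (2 * k))

theorem blockStart_le {h : ℕ → ℕ} (hh : IsOrder h) (n : ℕ) : blockStart hh (h n / 2) ≤ n :=
  Nat.find_min' (hh.2 _) (Nat.mul_div_le _ _)

/-- This bounds the lengths in a block, hence, `t` being monotone, the running times and the lengths
of the programs concerned. -/
theorem le_blockStart_succ {h : ℕ → ℕ} (hh : IsOrder h) (n : ℕ) :
    n ≤ blockStart hh (h n / 2 + 1) := by
  by_contra! hlt
  have := two_mul_le_blockStart hh (h n / 2 + 1)
  have := hh.1 hlt.le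
  omega

/-- The pair of a program with index `p.1` and an output with index `p.2`, computed in time `t`, is
eligible at stage `s` if the output extends a string that is still alive at the first level of its
block. -/
def Eligible (U : Machine) {h : ℕ → ℕ} (hh : IsOrder h) (A : List Bool → ℕ → Prop) (t : ℕ → ℕ)
    (p : ℕ × ℕ) (s : ℕ) : Prop :=
  OutputsInTime U (stringOf p.1) (stringOf p.2) (t (stringOf p.2).length) ∧
    AliveAt A ((stringOf p.2).take (blockStart hh (h (stringOf p.2).length / 2))) s

/-! ### Eligible programs: computable stages and compression. -/

section

variable {U : Machine} {h : ℕ → ℕ} {hh : IsOrder h} {A : List Bool → ℕ → Prop} {t : ℕ → ℕ}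

theorem computablePred_eligible (hU : IsUniversalPrefixFree U) (hc : Computable h)
    (hA : ComputablePred fun p : List Bool × ℕ => A p.1 p.2) (ht : Computable t) :
    ComputablePred fun x : (ℕ × ℕ) × ℕ => Eligible U hh A t x.1 x.2 := by
  have he : Computable fun x : (ℕ × ℕ) × ℕ => stringOf x.1.1 :=
    computable_stringOf.comp (Computable.fst.comp Computable.fst)
  have hd : Computable fun x : (ℕ × ℕ) × ℕ => stringOf x.1.2 :=
    computable_stringOf.comp (Computable.snd.comp Computable.fst)
  have hlen := Computable.list_length.comp hd
  refine ((primrecPred_outputsInTime U hU.finite_alphabet).computablePred.comp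
    ((he.pair hd).pair (ht.comp hlen))).and ((computablePred_aliveAt hA).comp
    ((Primrec.list_take.to_comp.comp ((computable_blockStart hh hc).comp
      (Primrec.nat_div.to_comp.comp (hc.comp hlen) (Computable.const 2))) hd).pair
      Computable.snd))

/-- The block of the output with index `p.2`. -/
noncomputable def blockOf (h : ℕ → ℕ) (p : ℕ × ℕ) : ℕ :=
  h (stringOf p.2).length / 2

theorem computable_blockOf (hc : Computable h) : Computable (blockOf h) :=
  Primrec.nat_div.to_comp.comp (hc.comp (Computable.list_length.comp
    (computable_stringOf.comp Computable.snd))) (Computable.const 2)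

/-- The indices of the pairs that can be eligible in a given block are bounded computably. -/
theorem exists_index_bound (hc : Computable h) (ht : IsComputableTimeBound t) :
    ∃ b : ℕ → ℕ, Computable b ∧ ∀ p s, Eligible U hh A t p s →
      p.1 < b (blockOf h p) ∧ p.2 < b (blockOf h p) := by
  obtain ⟨B, hB⟩ := exists_length_program_le U
  have hnext : Computable fun k => blockStart hh (k + 1) :=
    (computable_blockStart hh hc).comp Computable.succ
  refine ⟨fun k => 2 ^ (blockStart hh (k + 1) + B * t (blockStart hh (k + 1)) + 1),
    computable_pow (Computable.const 2) (Computable.succ.comp (Primrec.nat_add.to_comp.comp hnext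
      (Primrec.nat_mul.to_comp.comp (Computable.const B) (ht.1.comp hnext)))), fun p s hp => ?_⟩
  have hlen := le_blockStart_succ hh (stringOf p.2).length
  have hprog := hB _ _ _ hp.1
  have htime := Nat.mul_le_mul_left B (ht.2 hlen)
  have h₁ := stringIndex_lt (σ := stringOf p.1) (hprog.trans (add_le_add hlen htime))
  have h₂ := stringIndex_lt (σ := stringOf p.2) (hlen.trans (Nat.le_add_right _
    (B * t (blockStart hh (h (stringOf p.2).length / 2 + 1)))))
  rw [stringIndex_stringOf] at h₁ h₂
  exact ⟨h₁, h₂⟩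

open Classical in
/-- For a deep class, one can compute for each block a stage at which the eligible programs have
small total weight. -/
theorem exists_computable_stage (hU : IsUniversalPrefixFree U) {M : List Bool → ℝ} {C : ℕ}
    (hC : ∀ (E : Finset (ℕ × ℕ)) (T : Finset (List Bool)) (m : ℕ),
      (∀ p ∈ E, Outputs U (stringOf p.1) (stringOf p.2) ∧ (stringOf p.2).take m ∈ T) →
      ∑ p ∈ E, programWeight p ≤ 2 ^ C * ∑ τ ∈ T, M τ)
    {W : List Bool → Prop} (hc : Computable h)
    (hdeep : ∀ n, ∑' σ : treeLevel {X | ∀ n, ¬ W (initSeg X n)} n, M σ ≤ (2 : ℝ)⁻¹ ^ h n)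
    (hA : ComputablePred fun p : List Bool × ℕ => A p.1 p.2) (hmono : ∀ σ, Monotone (A σ))
    (hW : ∀ σ, W σ ↔ ∃ s, A σ s) (ht : IsComputableTimeBound t) :
    ∃ stage : ℕ → ℕ, Computable stage ∧ ∀ (k : ℕ) (E : Finset (ℕ × ℕ)),
      (∀ p ∈ E, Eligible U hh A t p (stage k) ∧ blockOf h p = k) →
      ∑ p ∈ E, programWeight p ≤ 2 ^ C * (2 : ℝ)⁻¹ ^ (2 * k) := by
  obtain ⟨b, hb, hbound⟩ := exists_index_bound (U := U) (hh := hh) (A := A) hc ht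
  set P : Set (ℕ → Bool) := {X | ∀ n, ¬ W (initSeg X n)}
  let block (k s : ℕ) : Finset (ℕ × ℕ) := (Finset.range (b k) ×ˢ Finset.range (b k)).filter
    fun p => Eligible U hh A t p s ∧ blockOf h p = k
  let num (k s : ℕ) : ℕ := ∑ e ∈ Finset.range (b k), ∑ d ∈ Finset.range (b k),
    if Eligible U hh A t (e, d) s ∧ blockOf h (e, d) = k then 2 ^ (b k - (stringOf e).length) else 0
  have hnum : ∀ k s, ∑ p ∈ block k s, programWeight p = num k s / 2 ^ b k := by
    intro k s
    rw [Finset.sum_filter, Finset.sum_product, Nat.cast_sum, Finset.sum_div]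
    refine Finset.sum_congr rfl fun e he => ?_
    rw [Nat.cast_sum, Finset.sum_div]
    refine Finset.sum_congr rfl fun d _ => ?_
    split_ifs
    · have : (stringOf e).length ≤ b k := (length_stringOf_le e).trans (Finset.mem_range.1 he).le
      rw [programWeight, Nat.cast_pow, Nat.cast_ofNat, eq_div_iff (by positivity), inv_pow]
      nth_rewrite 1 [← Nat.sub_add_cancel this]
      rw [pow_add]
      field_simp
    · simp
  have hstage : ∀ k s, num k s * 2 ^ (2 * k) ≤ 2 ^ (C + b k) ↔
      ∑ p ∈ block k s, programWeight p ≤ 2 ^ C * (2 : ℝ)⁻¹ ^ (2 * k) := by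
    intro k s
    rw [hnum, inv_pow, ← div_eq_mul_inv, div_le_div_iff₀ (by positivity) (by positivity), ← pow_add]
    norm_cast
  have hex : ∀ k, ∃ s, num k s * 2 ^ (2 * k) ≤ 2 ^ (C + b k) := by
    intro k
    have hT := finite_treeLevel P (blockStart hh k)
    -- The second alternative covers outputs too short to reach the first level of the block, where
    -- `take` returns the whole string; no output of block `k` is that short.
    have hdead : ∀ d ∈ Finset.range (b k), ∀ᶠ s in atTop,
        AliveAt A ((stringOf d).take (blockStart hh k)) s →
          (stringOf d).take (blockStart hh k) ∈ hT.toFinset ∨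
            (stringOf d).length < blockStart hh k := by
      intro d _
      by_cases hd : ∀ s, AliveAt A ((stringOf d).take (blockStart hh k)) s
      · refine Eventually.of_forall fun s _ => ?_
        obtain ⟨X, hX, heq⟩ := exists_initSeg_of_aliveAt hmono hW hd
        refine (lt_or_ge _ _).symm.imp_left fun hlen => ?_
        rw [List.length_take, min_eq_left hlen] at heq
        exact hT.mem_toFinset.2 ⟨X, hX, heq⟩
      · obtain ⟨s₀, hs₀⟩ := not_forall.1 hd
        filter_upwards [eventually_ge_atTop s₀] with s hs halive
        exact absurd (halive.mono hmono hs) hs₀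
    obtain ⟨s, hs⟩ := ((Filter.eventually_all_finset _).2 hdead).exists
    refine ⟨s, (hstage k s).2 ((hC _ hT.toFinset (blockStart hh k) fun p hp => ?_).trans ?_)⟩
    · obtain ⟨hp, ⟨hout, halive⟩, hk⟩ := Finset.mem_filter.1 hp
      rw [← blockOf, hk] at halive
      refine ⟨outputs_iff.2 ⟨_, hout⟩, (hs p.2 (Finset.mem_product.1 hp).2 halive).resolve_right ?_⟩
      rw [not_lt, ← hk]
      exact blockStart_le hh _
    · refine mul_le_mul_of_nonneg_left ?_ (by positivity)
      have htsum := hdeep (blockStart hh k)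
      rw [← hT.coe_toFinset, Finset.tsum_subtype'] at htsum
      exact htsum.trans (pow_le_pow_of_le_one (by norm_num) (by norm_num)
        (two_mul_le_blockStart hh k))
  have hcomp : ComputablePred fun x : ℕ × ℕ => num x.1 x.2 * 2 ^ (2 * x.1) ≤ 2 ^ (C + b x.1) := by
    have hmul : Computable₂ ((· * ·) : ℕ → ℕ → ℕ) := Primrec.nat_mul.to_comp
    have hbk : Computable fun x : ℕ × ℕ => b x.1 := hb.comp Computable.fst
    refine computablePred_le (hmul.comp ?_ (computable_pow (Computable.const 2)
      (hmul.comp (Computable.const 2) Computable.fst))) (computable_pow (Computable.const 2)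
        (Primrec.nat_add.to_comp.comp (Computable.const C) hbk))
    refine computable_sum_range ?_ hbk
    refine computable_sum_range ?_ (hbk.comp Computable.fst)
    have hp : Computable fun x : ((ℕ × ℕ) × ℕ) × ℕ => (x.1.2, x.2) :=
      (Computable.snd.comp Computable.fst).pair Computable.snd
    have hx : Computable fun x : ((ℕ × ℕ) × ℕ) × ℕ => x.1.1 := Computable.fst.comp Computable.fst
    exact computable_ite (((computablePred_eligible hU hc hA ht.1).comp
      (hp.pair (Computable.snd.comp hx))).and (computablePred_eq ((computable_blockOf hc).comp hp)
        (Computable.fst.comp hx))) (computable_pow (Computable.const 2)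
          (Primrec.nat_sub.to_comp.comp (hbk.comp hx) (Computable.list_length.comp
            (computable_stringOf.comp (Computable.snd.comp Computable.fst)))))
      (Computable.const 0)
  refine ⟨fun k => Nat.find (hex k), Computable.find hcomp hex, fun k E hE => ?_⟩
  refine le_trans (Finset.sum_le_sum_of_subset_of_nonneg (fun p hp => ?_)
    fun p _ _ => programWeight_nonneg p) ((hstage k _).1 (Nat.find_spec (hex k)))
  obtain ⟨hel, hk⟩ := hE p hp
  have := hbound p _ hel
  rw [hk] at this
  exact Finset.mem_filter.2 ⟨by simpa using this, hel, hk⟩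

open Classical in
/-- If the eligible programs of the block `k` have total weight at most `2 ^ C / 4 ^ k`, then their
outputs have programs that are shorter by `k`, up to an additive constant. -/
theorem exists_shorter_programs (hU : IsUniversalPrefixFree U) (hc : Computable h)
    (hA : ComputablePred fun p : List Bool × ℕ => A p.1 p.2) (ht : Computable t) {C : ℕ}
    {stage : ℕ → ℕ} (hs : Computable stage) (hstage : ∀ (k : ℕ) (E : Finset (ℕ × ℕ)),
      (∀ p ∈ E, Eligible U hh A t p (stage k) ∧ blockOf h p = k) →
      ∑ p ∈ E, programWeight p ≤ 2 ^ C * (2 : ℝ)⁻¹ ^ (2 * k)) :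
    ∃ c, ∀ p, Eligible U hh A t p (stage (blockOf h p)) → ∃ ρ : List Bool,
      ρ.length + blockOf h p ≤ (stringOf p.1).length + c ∧ Outputs U ρ (stringOf p.2) := by
  let D (i : ℕ) : Prop := Eligible U hh A t i.unpair (stage (blockOf h i.unpair))
  -- The extra `1` halves the weights, so that the blocks contribute at most `1/2 + 1/4 + ...`.
  let l (i : ℕ) : ℕ := (stringOf i.unpair.1).length + (C + 1) - blockOf h i.unpair
  have hblock : Computable fun i : ℕ => blockOf h i.unpair :=
    (computable_blockOf hc).comp Computable.unpair
  have hD : ComputablePred D :=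
    (computablePred_eligible hU hc hA ht).comp (Computable.unpair.pair (hs.comp hblock))
  have hl : Computable l := Primrec.nat_sub.to_comp.comp (Primrec.nat_add.to_comp.comp
    (Computable.list_length.comp (computable_stringOf.comp
      (Computable.fst.comp Computable.unpair))) (Computable.const (C + 1))) hblock
  have hout : Computable fun i : ℕ => stringOf i.unpair.2 :=
    computable_stringOf.comp (Computable.snd.comp Computable.unpair)
  -- The weight bound applied to a single pair forces its program to be long, so the subtraction in
  -- `l` is not truncated.
  have hle : ∀ p, Eligible U hh A t p (stage (blockOf h p)) →
      2 * blockOf h p ≤ (stringOf p.1).length + C := by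
    intro p hp
    have := hstage (blockOf h p) {p} fun q hq => by
      rw [Finset.mem_singleton] at hq; subst hq; exact ⟨hp, rfl⟩
    rw [Finset.sum_singleton, programWeight, inv_pow, inv_pow, ← div_eq_mul_inv, ← one_div,
      div_le_div_iff₀ (by positivity) (by positivity), one_mul, ← pow_add,
      pow_le_pow_iff_right₀ one_lt_two] at this
    omega
  have hweight : ∀ i, D i → (2 : ℝ)⁻¹ ^ l i =
      (2 : ℝ)⁻¹ ^ (C + 1) * 2 ^ blockOf h i.unpair * programWeight i.unpair := by
    intro i hi
    have := hle _ hi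
    have hli : l i + blockOf h i.unpair = (stringOf i.unpair.1).length + (C + 1) :=
      Nat.sub_add_cancel (by omega)
    rw [programWeight, mul_right_comm, ← pow_add, add_comm (C + 1), ← hli, pow_add, mul_assoc,
      ← mul_pow]
    norm_num
  have hsum : ∀ n, requestWeight D l n ≤ 1 := by
    intro n
    set E := (Finset.range n).filter D
    set κ := E.sup (fun i => blockOf h i.unpair) + 1
    have hκ : ∀ i ∈ E, blockOf h i.unpair ∈ Finset.range κ := fun i hi =>
      Finset.mem_range.2 (Nat.lt_succ_of_le (Finset.le_sup (f := fun i : ℕ => blockOf h i.unpair) hi))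
    have hblocks : ∀ k, ∑ i ∈ E.filter (fun i => blockOf h i.unpair = k), (2 : ℝ)⁻¹ ^ l i ≤
        (2 : ℝ)⁻¹ * (2 : ℝ)⁻¹ ^ k := by
      intro k
      have h₁ := hstage k ((E.filter fun i => blockOf h i.unpair = k).image Nat.unpair) <| by
        intro p hp
        obtain ⟨i, hi, rfl⟩ := Finset.mem_image.1 hp
        obtain ⟨hiE, rfl⟩ := Finset.mem_filter.1 hi
        exact ⟨(Finset.mem_filter.1 hiE).2, rfl⟩
      rw [Finset.sum_image (g := Nat.unpair) Nat.pairEquiv.symm.injective.injOn] at h₁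
      calc ∑ i ∈ E.filter (fun i => blockOf h i.unpair = k), (2 : ℝ)⁻¹ ^ l i
          = (2 : ℝ)⁻¹ ^ (C + 1) * 2 ^ k *
            ∑ i ∈ E.filter (fun i => blockOf h i.unpair = k), programWeight i.unpair := by
            rw [Finset.mul_sum]
            refine Finset.sum_congr rfl fun i hi => ?_
            obtain ⟨hiE, rfl⟩ := Finset.mem_filter.1 hi
            exact hweight i (Finset.mem_filter.1 hiE).2
        _ ≤ (2 : ℝ)⁻¹ ^ (C + 1) * 2 ^ k * (2 ^ C * (2 : ℝ)⁻¹ ^ (2 * k)) :=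
            mul_le_mul_of_nonneg_left h₁ (by positivity)
        _ = (2 : ℝ)⁻¹ * (2 : ℝ)⁻¹ ^ k := by
            simp only [inv_pow, pow_succ, two_mul, pow_add]
            field_simp
    calc requestWeight D l n = ∑ i ∈ E, (2 : ℝ)⁻¹ ^ l i := (Finset.sum_filter _ _).symm
      _ = ∑ k ∈ Finset.range κ, ∑ i ∈ E.filter (fun i => blockOf h i.unpair = k),
          (2 : ℝ)⁻¹ ^ l i := (Finset.sum_fiberwise_of_maps_to hκ _).symm
      _ ≤ ∑ k ∈ Finset.range κ, (2 : ℝ)⁻¹ * (2 : ℝ)⁻¹ ^ k :=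
          Finset.sum_le_sum fun k _ => hblocks k
      _ ≤ 1 := by
          rw [← Finset.mul_sum, geom_sum_eq (by norm_num)]
          have hpos : (0 : ℝ) < 2⁻¹ ^ κ := by positivity
          generalize (2 : ℝ)⁻¹ ^ κ = x at hpos
          have : (2 : ℝ)⁻¹ * ((x - 1) / (2⁻¹ - 1)) = 1 - x := by ring
          linarith
  obtain ⟨c, hprog⟩ := exists_programs hU hD hl hout hsum
  refine ⟨C + 1 + c, fun ⟨e, d⟩ hp => ?_⟩
  obtain ⟨ρ, hρ, hρout⟩ := hprog (Nat.pair e d) (by simpa [D] using hp)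
  have : 2 * blockOf h (e, d) ≤ (stringOf e).length + C := hle _ hp
  simp only [l, Nat.unpair_pair] at hρ hρout
  exact ⟨ρ, show ρ.length + blockOf h (e, d) ≤ (stringOf e).length + (C + 1 + c) by omega, hρout⟩

end

theorem IsDeepClass.isOrderDeep {U : Machine} (hU : IsUniversalPrefixFree U) {M : List Bool → ℝ}
    (hM : IsUniversalSemimeasure M) {P : Set (ℕ → Bool)} (hP : IsDeepClass M P) {X : ℕ → Bool}
    (hX : X ∈ P) : IsOrderDeep U X := by
  obtain ⟨⟨W, hWre, rfl⟩, h, hc, hh, hdeep⟩ := hP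
  obtain ⟨A, hA, hmono, hW⟩ := exists_computable_stages hWre
  obtain ⟨C, hC⟩ := exists_sum_programWeight_le hU hM
  refine ⟨fun n => h n / 4, Primrec.nat_div.to_comp.comp hc (Computable.const 4),
    ⟨fun m n hmn => Nat.div_le_div_right (hh.1 hmn), fun k => ?_⟩, fun t ht => ?_⟩
  · obtain ⟨n, hn⟩ := hh.2 (4 * k)
    exact ⟨n, (Nat.le_div_iff_mul_le (by norm_num)).2 (by omega)⟩
  obtain ⟨stage, hs, hstage⟩ := exists_computable_stage (hh := hh) hU hC hc hdeep hA hmono hW ht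
  obtain ⟨c, hprog⟩ := exists_shorter_programs hU hc hA ht.1 hs hstage
  -- Once `h n ≥ 4 * c`, the gap between `h n / 2` and `h n / 4` is at least `c`.
  obtain ⟨n₀, hn₀⟩ := hh.2 (4 * c)
  filter_upwards [eventually_ge_atTop n₀] with n hn
  refine le_iInf₂ fun ρ hρ => ?_
  obtain ⟨π, hπ, hout⟩ := hprog (stringIndex ρ, stringIndex (initSeg X n)) <| by
    refine ⟨by simpa only [stringOf_stringIndex] using hρ, ?_⟩
    simp only [stringOf_stringIndex, length_initSeg]
    rw [take_initSeg X (blockStart_le hh n)]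
    exact aliveAt_initSeg hW hX _ _
  simp only [blockOf, stringOf_stringIndex, length_initSeg] at hπ hout
  have hK : K U (initSeg X n) ≤ π.length := iInf₂_le π hout
  refine (add_le_add_left hK _).trans ?_
  have := hn₀.trans (hh.1 hn)
  exact_mod_cast (by omega : π.length + h n / 4 ≤ ρ.length)

end DeepClasses

theorem mainTheorem1 (U : DeepClasses.Machine) (hU : DeepClasses.IsUniversalPrefixFree U)
    (M : List Bool → ℝ) (hM : DeepClasses.IsUniversalSemimeasure M)
    (P : Set (ℕ → Bool)) (hP : DeepClasses.IsDeepClass M P) :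
    ∀ X ∈ P, DeepClasses.IsOrderDeep U X ∧ DeepClasses.IsStronglyDeep U X :=
  fun _ hX => have h := hP.isOrderDeep hU hM hX; ⟨h, h.isStronglyDeep⟩
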